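/- Let $F=\{f_k\}_{k\ge 0}$ and $G=\{g_k\}_{k\ge 0}$ be probability distributions on the nonnegative integers with the same finite mean $\mu>0$. Suppose that there are $\alpha,\beta>1$ and functions $L_F,L_G$ slowly varying at infinity (that is, $L(tx)/L(x)\to1$ as $x\to\infty$ for every $t>0$) such that $\sum_{k>x}f_k\le x^{-\alpha}L_F(x)$ and $\sum_{k>x}g_k\le x^{-\beta}L_G(x)$ for all $x>0$. Let $\kappa=\min\{1-\alpha^{-1},\,1-\beta^{-1},\,1/2\}$ and fix $0<\delta_0<\kappa$. For each $n$, construct random sequences $\mathbf N=(N_1,\dots,N_n)$ and $\mathbf D=(D_1,\dots,D_n)$ as follows. Sample $\gamma_1,\dots,\gamma_n$ i.i.d. from $F$ and, independently, $\xi_1,\dots,\xi_n$ i.i.d. from $G$, and repeat this until $\Delta_n=\sum_{i=1}^n\gamma_i-\sum_{i=1}^n\xi_i$ satisfies $|\Delta_n|\le n^{1-\kappa+\delta_0}$. Then choose $|\Delta_n|$ of the $n$ nodes uniformly at random without replacement. If $\Delta_n\ge0$, let $D_i=\xi_i+1$ for the chosen nodes, $D_i=\xi_i$ for the other nodes, and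 $N_i=\gamma_i$ for all $i$. If $\Delta_n<0$, let $N_i=\gamma_i+1$ for the chosen nodes, $N_i=\gamma_i$ for the other nodes, and $D_i=\xi_i$ for all $i$. Thus $\sum_i N_i=\sum_i D_i$. In the directed configuration model with bi-degree-sequence $(\mathbf N,\mathbf D)$, node $i$ receives $N_i$ inbound and $D_i$ outbound half-edges, and the inbound half-edges are matched with the outbound half-edges uniformly at random, each matched pair giving a directed edge from the node of the outbound half-edge to the node of the inbound one. A directed multigraph is simple if it has no self-loops and at most one edge in each direction between any two nodes. In the repeated directed configuration model, $(\mathbf N,\mathbf D)$ and the matching are drawn anew until the resulting multigraph is simple; that is, the final graph has the conditional law of the multigraph given that it is simple. Let $N_k^{(r)}$ and $D_k^{(r)}$ be the in-degree and out-degree of node $k$ in the final simple graph, and define, for $i,j,k\ge0$, $$h^{(n)}(i,j)=\frac1n\sum_{v=1}^nP\bigl(N_v^{(r)}=i,\;D_v^{(r)}=j\bigr),\qquad \widehat{f_k}^{(n)}=\frac1n\sum_{v=1}^n1\bigl(N_v^{(r)}=k\bigr),\qquad \widehat{g_k}^{(n)}=\frac1n\sum_{v=1}^n1\bigl(D_v^{(r)}=k\bigr).$$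 Then, for all sufficiently large $n$, the multigraph is simple with positive probability (so that the model is well defined), and, as $n\to\infty$, (a) $h^{(n)}(i,j)\to f_i\,g_j$ for all $i,j\ge0$; (b) $\widehat{f_k}^{(n)}\to f_k$ and $\widehat{g_k}^{(n)}\to g_k$ in probability, for all $k\ge0$. -/

import Mathlib

open MeasureTheory ProbabilityTheory Filter Topology
open scoped ENNReal

noncomputable section

namespace DirectedConfig

/-- `L` is slowly varying at infinity. -/
def SlowlyVarying (L : ℝ → ℝ) : Prop :=
  ∀ t : ℝ, 0 < t → Tendsto (fun x : ℝ => L (t * x) / L x) atTop (𝓝 1)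

/-- The tail `∑_{k > x} f_k` of a distribution on the nonnegative integers. -/
def tail (F : PMF ℕ) (x : ℝ) : ℝ :=
  ∑' k : {k : ℕ // x < (k : ℝ)}, (F k.1).toReal

/-- `κ = min {1 - 1/α, 1 - 1/β, 1/2}`. -/
def kappa (α β : ℝ) : ℝ := min (min (1 - α⁻¹) (1 - β⁻¹)) (1 / 2)

/-- A pair of sequences of nonnegative integers indexed by the `n` nodes: in-degrees first,
out-degrees second. -/
abbrev BiSeq (n : ℕ) : Type := (Fin n → ℕ) × (Fin n → ℕ)

/-- A directed multigraph on `n` labelled nodes: `E i j` is the number of edges from `i` to `j`. -/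
abbrev Multigraph (n : ℕ) : Type := Fin n → Fin n → ℕ

/-- The law of `f a` when `a` is uniformly distributed on the finite set `s`. -/
def uniformLaw {ι Ω : Type*} [MeasurableSpace Ω] (s : Finset ι) (f : ι → Ω) : Measure Ω :=
  (s.card : ℝ≥0∞)⁻¹ • ∑ a ∈ s, Measure.dirac (f a)

/-- The law of `(γ, ξ)`: independent i.i.d. samples of size `n` from `F` and from `G`. -/
def sampleLaw (F G : PMF ℕ) (n : ℕ) : Measure (BiSeq n) :=
  (Measure.pi fun _ : Fin n => F.toMeasure).prod (Measure.pi fun _ : Fin n => G.toMeasure)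

/-- `Δ = ∑ γ_i - ∑ ξ_i`. -/
def delta {n : ℕ} (p : BiSeq n) : ℤ := (∑ i, (p.1 i : ℤ)) - ∑ i, (p.2 i : ℤ)

/-- The acceptance event `|Δ_n| ≤ n ^ (1 - κ + δ₀)`. -/
def accept (α β δ₀ : ℝ) (n : ℕ) : Set (BiSeq n) :=
  {p | |(delta p : ℝ)| ≤ (n : ℝ) ^ (1 - kappa α β + δ₀)}

/-- Add one to the out-degrees of the nodes in `A` if `Δ ≥ 0`, and to their in-degrees if
`Δ < 0`. -/
def adjust {n : ℕ} (p : BiSeq n) (A : Finset (Fin n)) : BiSeq n :=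
  (fun i => p.1 i + if delta p < 0 ∧ i ∈ A then 1 else 0,
   fun i => p.2 i + if 0 ≤ delta p ∧ i ∈ A then 1 else 0)

/-- The law of the bi-degree-sequence `(N, D)`: sample `(γ, ξ)` until it is accepted (so that the
accepted sample has the conditional law given acceptance), then adjust it at `|Δ|` nodes chosen
uniformly without replacement. -/
def biDegreeLaw (F G : PMF ℕ) (α β δ₀ : ℝ) (n : ℕ) : Measure (BiSeq n) :=
  (cond (sampleLaw F G n) (accept α β δ₀ n)).bind fun p =>
    uniformLaw ((Finset.univ : Finset (Fin n)).powersetCard (delta p).natAbs) (adjust p)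

/-- The inbound half-edges (for `a` the in-degrees) or outbound half-edges (for `a` the
out-degrees): node `i` carries `a i` of them. -/
abbrev HalfEdge {n : ℕ} (a : Fin n → ℕ) : Type := Σ i : Fin n, Fin (a i)

/-- The multigraph obtained from a matching of the inbound half-edges to the outbound half-edges:
each pair made of an inbound half-edge of `j` and an outbound half-edge of `i` gives an edge from
`i` to `j`. -/
def toMultigraph {n : ℕ} {m d : Fin n → ℕ} (σ : HalfEdge m ≃ HalfEdge d) : Multigraph n :=
  fun i j => (Finset.univ.filter fun h : HalfEdge m => h.1 = j ∧ (σ h).1 = i).card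

/-- The directed configuration model with bi-degree-sequence `(m, d)`: the half-edges are matched
uniformly at random. -/
def configLaw {n : ℕ} (p : BiSeq n) : Measure (Multigraph n) :=
  uniformLaw (Finset.univ : Finset (HalfEdge p.1 ≃ HalfEdge p.2)) toMultigraph

/-- The law of the multigraph given by the directed configuration model with random
bi-degree-sequence `(N, D)`. -/
def multigraphLaw (F G : PMF ℕ) (α β δ₀ : ℝ) (n : ℕ) : Measure (Multigraph n) :=
  (biDegreeLaw F G α β δ₀ n).bind configLaw

/-- No self-loops, and at most one edge in each direction between two nodes. -/
def IsSimple {n : ℕ} (E : Multigraph n) : Prop :=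
  (∀ i, E i i = 0) ∧ ∀ i j, E i j ≤ 1

/-- The law of the final simple graph in the repeated directed configuration model: `(N, D)` and
the matching are drawn anew until the multigraph is simple, so this is the conditional law of the
multigraph given that it is simple. -/
def repeatedLaw (F G : PMF ℕ) (α β δ₀ : ℝ) (n : ℕ) : Measure (Multigraph n) :=
  cond (multigraphLaw F G α β δ₀ n) {E | IsSimple E}

/-- The in-degree of a node. -/
def inDegree {n : ℕ} (E : Multigraph n) (v : Fin n) : ℕ := ∑ u, E u v

/-- The out-degree of a node. -/
def outDegree {n : ℕ} (E : Multigraph n) (v : Fin n) : ℕ := ∑ u, E v u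

/-- `h^{(n)}(i, j)`: the joint distribution of the in-degree and the out-degree in the final
simple graph, averaged over the nodes. -/
def jointDegree (F G : PMF ℕ) (α β δ₀ : ℝ) (n i j : ℕ) : ℝ :=
  (1 / (n : ℝ)) * ∑ v : Fin n,
    (repeatedLaw F G α β δ₀ n).real {E | inDegree E v = i ∧ outDegree E v = j}

/-- The fraction of nodes of in-degree `k`. -/
def empIn {n : ℕ} (E : Multigraph n) (k : ℕ) : ℝ :=
  (1 / (n : ℝ)) * ∑ v : Fin n, if inDegree E v = k then 1 else 0

/-- The fraction of nodes of out-degree `k`. -/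
def empOut {n : ℕ} (E : Multigraph n) (k : ℕ) : ℝ :=
  (1 / (n : ℝ)) * ∑ v : Fin n, if outDegree E v = k then 1 else 0

end DirectedConfig

end

/-! Conditioning on simplicity divides probabilities by the probability of a simple graph, so it
suffices to compare two exponential rates. Upper bound (`eventually_lintegral_emp_le`): matching
preserves degrees and the adjustment touches at most n^(1-κ+δ₀) = o(n) nodes. An empirical degree
frequency off by ε therefore forces the raw i.i.d. sample to be off by ε/2, and Hoeffding bounds
this by 2 exp(-ε²n/8), whatever the tails of F and G. Lower bound
(`eventually_exp_le_lintegral_isSimple`): for each η > 0, acceptance followed by a simple graph has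
probability at least exp(-ηn) for large n. By `exists_bounded_pmf_of_mean`, F and G dominate, up to
a factor c > 1 as close to 1 as desired, bounded distributions with the same mean; this change of
measure costs c^(2n). Under the bounded laws the imbalance is centred with fluctuations of order √n,
below n^(1-κ+δ₀) since the exponent exceeds 1/2. With bounded degrees a switching argument
(`card_equiv_le_card_badCount_eq_zero`) makes a matching simple with at least polynomially small
probability. Taking η = ε²/16 sends the ratio to 0. Sets of the form {k} × ℕ and ℕ × {k} give (b);
for (a), the joint degree distribution is the mean of an empirical frequency with values in [0, 1].
-/

noncomputable section

namespace DirectedConfig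

/-! ### Switchings: simple matchings under bounded degrees. -/

section Matching

variable {X Y V : Type*} [Fintype X] [Fintype Y]

/-- In the matching `σ` of half-edges sitting at the nodes `a x` and `b y`, the half-edge `x` is
part of a self-loop or of a multiple edge. -/
def IsBad (a : X → V) (b : Y → V) (σ : X ≃ Y) (x : X) : Prop :=
  b (σ x) = a x ∨ ∃ x', x' ≠ x ∧ a x' = a x ∧ b (σ x') = b (σ x)

open Classical in
/-- The number of half-edges that are part of a self-loop or of a multiple edge. -/
def badCount (a : X → V) (b : Y → V) (σ : X ≃ Y) : ℕ :=
  (Finset.univ.filter (IsBad a b σ)).card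

open Classical in
theorem card_filter_comp_equiv_le (b : Y → V) (σ : X ≃ Y) {K : ℕ}
    (hb : ∀ v, (Finset.univ.filter fun y => b y = v).card ≤ K) (v : V) :
    (Finset.univ.filter fun x => b (σ x) = v).card ≤ K := by
  refine le_trans (le_of_eq ?_) (hb v)
  refine Finset.card_bij (fun x _ => σ x) (by simp) (by simp) ?_
  intro y hy
  exact ⟨σ.symm y, by simpa using hy, by simp⟩

variable [DecidableEq X]

-- Exchange the partner of a bad half-edge x with that of a z for which neither new edge is a loop
-- or parallel to another edge. This repairs x and makes nothing else bad; at most 2K + 2K² choices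
-- of z are excluded.
open Classical in
theorem exists_swap_badCount_lt (a : X → V) (b : Y → V) {K : ℕ}
    (ha : ∀ v, (Finset.univ.filter fun x => a x = v).card ≤ K)
    (hb : ∀ v, (Finset.univ.filter fun y => b y = v).card ≤ K)
    (hK : 2 * K + 2 * (K * K) < Fintype.card X) (σ : X ≃ Y) (hσ : badCount a b σ ≠ 0) :
    ∃ x x', badCount a b ((Equiv.swap x x').trans σ) < badCount a b σ := by
  obtain ⟨x, hx⟩ := Finset.card_ne_zero.1 hσ
  replace hx : IsBad a b σ x := by simpa using hx
  have hbσ := card_filter_comp_equiv_le b σ hb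
  -- Choices of z to avoid: `A₁` and `A₂` make the new edge at x a loop or parallel to an edge, `A₃`
  -- and `A₄` do the same for the new edge at z.
  let A₁ := Finset.univ.filter fun z => b (σ z) = a x
  let A₂ := (Finset.univ.filter fun z => a z = a x).biUnion
    fun w => Finset.univ.filter fun z => b (σ z) = b (σ w)
  let A₃ := Finset.univ.filter fun z => a z = b (σ x)
  let A₄ := (Finset.univ.filter fun z => b (σ z) = b (σ x)).biUnion
    fun w => Finset.univ.filter fun z => a z = a w
  have h₁ : A₁.card ≤ K := hbσ _
  have h₂ : A₂.card ≤ K * K := (Finset.card_biUnion_le_card_mul _ _ K fun w _ => hbσ _).trans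
    (Nat.mul_le_mul_right _ (ha _))
  have h₃ : A₃.card ≤ K := ha _
  have h₄ : A₄.card ≤ K * K := (Finset.card_biUnion_le_card_mul _ _ K fun w _ => ha _).trans
    (Nat.mul_le_mul_right _ (hbσ _))
  have hcard : (A₁ ∪ A₂ ∪ A₃ ∪ A₄).card < Fintype.card X := by
    have := Finset.card_union_le (A₁ ∪ A₂ ∪ A₃) A₄
    have := Finset.card_union_le (A₁ ∪ A₂) A₃
    have := Finset.card_union_le A₁ A₂
    omega
  obtain ⟨z, hz⟩ : ∃ z, z ∉ A₁ ∪ A₂ ∪ A₃ ∪ A₄ := by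
    by_contra! h
    exact hcard.ne (by rw [Finset.eq_univ_of_forall h, Finset.card_univ])
  simp only [A₁, A₂, A₃, A₄, Finset.mem_union, Finset.mem_biUnion, Finset.mem_filter,
    Finset.mem_univ, true_and, not_or, not_exists, not_and] at hz
  obtain ⟨⟨⟨hz₁, hz₂⟩, hz₃⟩, hz₄⟩ := hz
  -- `A₂` also contains x itself and every half-edge at the node of x (take w = x, respectively w =
  -- z).
  have hxz : z ≠ x := fun h => hz₂ x rfl (by rw [h])
  have hax : a z ≠ a x := fun h => hz₂ z h rfl
  have hbx : b (σ z) ≠ b (σ x) := hz₂ x rfl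
  refine ⟨x, z, Finset.card_lt_card ?_⟩
  rw [Finset.ssubset_iff_of_subset]
  · refine ⟨x, by simpa using hx, ?_⟩
    simp only [Finset.mem_filter, Finset.mem_univ, true_and, IsBad, Equiv.trans_apply,
      Equiv.swap_apply_left, not_or, not_exists, not_and]
    refine ⟨hz₁, fun w hw haw => ?_⟩
    have hwz : w ≠ z := fun h => hax (h ▸ haw)
    rw [Equiv.swap_apply_of_ne_of_ne hw hwz]
    exact fun h => hz₂ w haw h.symm
  · intro w
    simp only [Finset.mem_filter, Finset.mem_univ, true_and, IsBad, Equiv.trans_apply]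
    intro hw
    by_cases hwx : w = x
    · subst hwx; exact hx
    by_cases hwz : w = z
    · subst hwz
      exfalso
      rw [Equiv.swap_apply_right] at hw
      rcases hw with hw | ⟨u, hu, hau, hbu⟩
      · exact hz₃ hw.symm
      · have hux : u ≠ x := fun h => hax (by rw [← hau, h])
        rw [Equiv.swap_apply_of_ne_of_ne hux hu] at hbu
        exact hz₄ u hbu hau.symm
    rw [Equiv.swap_apply_of_ne_of_ne hwx hwz] at hw
    rcases hw with hw | ⟨u, hu, hau, hbu⟩
    · exact Or.inl hw
    by_cases hux : u = x
    · subst hux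
      rw [Equiv.swap_apply_left] at hbu
      exact absurd hbu (hz₂ w hau.symm)
    by_cases huz : u = z
    · subst huz
      rw [Equiv.swap_apply_right] at hbu
      exact absurd hau (hz₄ w hbu.symm)
    rw [Equiv.swap_apply_of_ne_of_ne hux huz] at hbu
    exact Or.inr ⟨u, hu, hau, hbu⟩

variable [DecidableEq Y]

-- Undoing the improving swap recovers the matching, and a swap is named by a pair of half-edges,
-- whence the squared factor.
open Classical in
theorem card_badCount_le_succ (a : X → V) (b : Y → V) {K : ℕ}
    (ha : ∀ v, (Finset.univ.filter fun x => a x = v).card ≤ K)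
    (hb : ∀ v, (Finset.univ.filter fun y => b y = v).card ≤ K)
    (hK : 2 * K + 2 * (K * K) < Fintype.card X) (j : ℕ) :
    (Finset.univ.filter fun σ : X ≃ Y => badCount a b σ ≤ j + 1).card ≤
      Fintype.card X ^ 2 * (Finset.univ.filter fun σ : X ≃ Y => badCount a b σ ≤ j).card := by
  have key : (Finset.univ.filter fun σ : X ≃ Y => badCount a b σ ≤ j + 1) ⊆
      ((Finset.univ : Finset (X × X)) ×ˢ
        (Finset.univ.filter fun σ : X ≃ Y => badCount a b σ ≤ j)).image
        fun q => (Equiv.swap q.1.1 q.1.2).trans q.2 := by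
    intro σ hσ
    replace hσ : badCount a b σ ≤ j + 1 := by simpa using hσ
    obtain ⟨x, x', h⟩ : ∃ x x', badCount a b ((Equiv.swap x x').trans σ) ≤ j := by
      by_cases h0 : badCount a b σ = 0
      · obtain ⟨x⟩ : Nonempty X := Fintype.card_pos_iff.1 (by omega)
        -- With nothing to repair, the swap of x with itself is the identity.
        exact ⟨x, x, by simp [h0]⟩
      · obtain ⟨x, x', h⟩ := exists_swap_badCount_lt a b ha hb hK σ h0
        exact ⟨x, x', by omega⟩
    refine Finset.mem_image.2 ⟨((x, x'), (Equiv.swap x x').trans σ), by simpa using h, ?_⟩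
    ext; simp
  calc _ ≤ _ := Finset.card_le_card key
    _ ≤ _ := Finset.card_image_le
    _ = _ := by rw [Finset.card_product, Finset.card_univ, Fintype.card_prod, sq]

-- Precomposing with a swap shows that all half-edges are equally likely to be sent to the node of
-- x, and each matching sends at most K of them there: a loop at x has probability at most K/M, for
-- M half-edges.
open Classical in
theorem card_mul_card_loop_le (a : X → V) (b : Y → V) {K : ℕ}
    (hb : ∀ v, (Finset.univ.filter fun y => b y = v).card ≤ K) (x : X) :
    Fintype.card X * (Finset.univ.filter fun σ : X ≃ Y => b (σ x) = a x).card ≤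
      K * Fintype.card (X ≃ Y) := by
  have h : ∀ z : X, (Finset.univ.filter fun σ : X ≃ Y => b (σ z) = a x).card =
      (Finset.univ.filter fun σ : X ≃ Y => b (σ x) = a x).card := by
    intro z
    refine Finset.card_bij' (fun σ _ => (Equiv.swap x z).trans σ)
      (fun σ _ => (Equiv.swap x z).trans σ) ?_ ?_ ?_ ?_
    · intro σ hσ; simpa using hσ
    · intro σ hσ; simpa using hσ
    · intro σ _; ext; simp
    · intro σ _; ext; simp
  calc _ = ∑ z : X, (Finset.univ.filter fun σ : X ≃ Y => b (σ z) = a x).card := by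
        simp [h]
    _ = ∑ σ : X ≃ Y, (Finset.univ.filter fun z : X => b (σ z) = a x).card := by
        simp only [Finset.card_filter]
        exact Finset.sum_comm
    _ ≤ ∑ σ : X ≃ Y, K := Finset.sum_le_sum fun σ _ => card_filter_comp_equiv_le b σ hb _
    _ = _ := by simp [mul_comm]

-- The same symmetry with x held fixed, over the M - 1 other half-edges.
open Classical in
theorem card_mul_card_multi_le (b : Y → V) {K : ℕ}
    (hb : ∀ v, (Finset.univ.filter fun y => b y = v).card ≤ K) {x x' : X} (hx : x' ≠ x) :
    (Fintype.card X - 1) * (Finset.univ.filter fun σ : X ≃ Y => b (σ x') = b (σ x)).card ≤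
      K * Fintype.card (X ≃ Y) := by
  have h : ∀ z ∈ Finset.univ.erase x,
      (Finset.univ.filter fun σ : X ≃ Y => b (σ z) = b (σ x)).card =
      (Finset.univ.filter fun σ : X ≃ Y => b (σ x') = b (σ x)).card := by
    intro z hz
    have hzx : z ≠ x := by simpa using hz
    refine Finset.card_bij' (fun σ _ => (Equiv.swap x' z).trans σ)
      (fun σ _ => (Equiv.swap x' z).trans σ) ?_ ?_ ?_ ?_
    · intro σ hσ; simpa [Equiv.swap_apply_of_ne_of_ne hx.symm hzx.symm] using hσ
    · intro σ hσ; simpa [Equiv.swap_apply_of_ne_of_ne hx.symm hzx.symm] using hσ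
    · intro σ _; ext; simp
    · intro σ _; ext; simp
  calc _ = ∑ z ∈ Finset.univ.erase x,
        (Finset.univ.filter fun σ : X ≃ Y => b (σ z) = b (σ x)).card := by
        rw [Finset.sum_congr rfl h, Finset.sum_const, Finset.card_erase_of_mem (Finset.mem_univ _),
          Finset.card_univ, smul_eq_mul]
    _ ≤ ∑ z : X, (Finset.univ.filter fun σ : X ≃ Y => b (σ z) = b (σ x)).card :=
        Finset.sum_le_sum_of_subset (Finset.erase_subset _ _)
    _ = ∑ σ : X ≃ Y, (Finset.univ.filter fun z : X => b (σ z) = b (σ x)).card := by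
        simp only [Finset.card_filter]
        exact Finset.sum_comm
    _ ≤ ∑ σ : X ≃ Y, K := Finset.sum_le_sum fun σ _ => card_filter_comp_equiv_le b σ hb _
    _ = _ := by simp [mul_comm]

-- Union bound: M possible loops of probability at most K/M, and at most MK ordered pairs at a
-- common node, each parallel with probability at most K/(M - 1). The factor 2 comes from M ≤ 2(M -
-- 1).
open Classical in
theorem sum_badCount_le (a : X → V) (b : Y → V) {K : ℕ}
    (ha : ∀ v, (Finset.univ.filter fun x => a x = v).card ≤ K)
    (hb : ∀ v, (Finset.univ.filter fun y => b y = v).card ≤ K)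
    (hX : 2 ≤ Fintype.card X) :
    ∑ σ : X ≃ Y, badCount a b σ ≤ (K + 2 * (K * K)) * Fintype.card (X ≃ Y) := by
  set M := Fintype.card X with hM
  set T := Fintype.card (X ≃ Y)
  let S : X → Finset X := fun x => Finset.univ.filter fun x' => x' ≠ x ∧ a x' = a x
  let c₁ : X → ℕ := fun x => (Finset.univ.filter fun σ : X ≃ Y => b (σ x) = a x).card
  let c₂ : X → X → ℕ := fun x x' =>
    (Finset.univ.filter fun σ : X ≃ Y => b (σ x') = b (σ x)).card
  have hS : ∀ x, (S x).card ≤ K := fun x =>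
    (Finset.card_le_card fun z hz => by
      simp only [S, Finset.mem_filter, Finset.mem_univ, true_and] at hz ⊢
      exact hz.2).trans (ha (a x))
  have hcount : ∑ σ : X ≃ Y, badCount a b σ ≤ ∑ x, (c₁ x + ∑ x' ∈ S x, c₂ x x') := by
    have : ∑ σ : X ≃ Y, badCount a b σ =
        ∑ x, (Finset.univ.filter fun σ : X ≃ Y => IsBad a b σ x).card := by
      simp only [badCount, Finset.card_filter]
      exact Finset.sum_comm
    rw [this]
    refine Finset.sum_le_sum fun x _ => ?_
    have hsub : (Finset.univ.filter fun σ : X ≃ Y => IsBad a b σ x) ⊆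
        (Finset.univ.filter fun σ : X ≃ Y => b (σ x) = a x) ∪
          (S x).biUnion fun x' => Finset.univ.filter fun σ : X ≃ Y => b (σ x') = b (σ x) := by
      intro σ hσ
      have hσ' : IsBad a b σ x := (Finset.mem_filter.1 hσ).2
      simp only [S, Finset.mem_union, Finset.mem_biUnion, Finset.mem_filter, Finset.mem_univ,
        true_and]
      rcases hσ' with h | ⟨x', h1, h2, h3⟩
      · exact Or.inl h
      · exact Or.inr ⟨x', ⟨h1, h2⟩, h3⟩
    exact (Finset.card_le_card hsub).trans ((Finset.card_union_le _ _).trans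
      (Nat.add_le_add_left Finset.card_biUnion_le _))
  have h₁ : ∑ x, c₁ x ≤ K * T := by
    refine Nat.le_of_mul_le_mul_left (c := M) ?_ (by omega)
    calc M * ∑ x, c₁ x = ∑ x, M * c₁ x := Finset.mul_sum _ _ _
      _ ≤ ∑ x : X, K * T := Finset.sum_le_sum fun x _ => card_mul_card_loop_le a b hb x
      _ = M * (K * T) := by simp [hM]
  have h₂ : ∑ x, ∑ x' ∈ S x, c₂ x x' ≤ 2 * (K * K) * T := by
    refine Nat.le_of_mul_le_mul_left (c := M - 1) ?_ (by omega)
    calc (M - 1) * ∑ x, ∑ x' ∈ S x, c₂ x x' = ∑ x, ∑ x' ∈ S x, (M - 1) * c₂ x x' := by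
          simp only [Finset.mul_sum]
      _ ≤ ∑ x, ∑ x' ∈ S x, K * T := by
          refine Finset.sum_le_sum fun x _ => Finset.sum_le_sum fun x' hx' => ?_
          exact card_mul_card_multi_le b hb (Finset.mem_filter.1 hx').2.1
      _ ≤ ∑ x : X, K * (K * T) := by
          refine Finset.sum_le_sum fun x _ => ?_
          rw [Finset.sum_const, smul_eq_mul]
          exact Nat.mul_le_mul_right _ (hS x)
      _ = M * (K * (K * T)) := by simp [hM]
      _ ≤ (2 * (M - 1)) * (K * (K * T)) := Nat.mul_le_mul_right _ (by omega)
      _ = _ := by ring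
  rw [Finset.sum_add_distrib] at hcount
  calc _ ≤ _ := hcount
    _ ≤ K * T + 2 * (K * K) * T := Nat.add_le_add h₁ h₂
    _ = _ := by ring

open Classical in
/-- If no node carries more than `K` half-edges of either kind, a uniform matching is simple with
probability at least polynomial in the number of half-edges. -/
theorem card_equiv_le_card_badCount_eq_zero (a : X → V) (b : Y → V) {K : ℕ}
    (ha : ∀ v, (Finset.univ.filter fun x => a x = v).card ≤ K)
    (hb : ∀ v, (Finset.univ.filter fun y => b y = v).card ≤ K)
    (hX : 2 ≤ Fintype.card X) (hK : 2 * K + 2 * (K * K) < Fintype.card X) :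
    Fintype.card (X ≃ Y) ≤ 2 * (Fintype.card X ^ 2) ^ (2 * (K + 2 * (K * K))) *
      (Finset.univ.filter fun σ : X ≃ Y => badCount a b σ = 0).card := by
  -- Twice the bound on the mean, so by Markov at least half of the matchings have at most B bad
  -- half-edges; B switchings then reach a simple one.
  set B := 2 * (K + 2 * (K * K)) with hB
  have hiter : ∀ j, (Finset.univ.filter fun σ : X ≃ Y => badCount a b σ ≤ j).card ≤
      (Fintype.card X ^ 2) ^ j *
        (Finset.univ.filter fun σ : X ≃ Y => badCount a b σ = 0).card := by
    intro j
    induction j with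
    | zero => simp
    | succ j ih =>
      calc _ ≤ _ := card_badCount_le_succ a b ha hb hK j
        _ ≤ _ := Nat.mul_le_mul_left _ ih
        _ = _ := by ring
  have hmarkov : (B + 1) * (Finset.univ.filter fun σ : X ≃ Y => ¬ badCount a b σ ≤ B).card ≤
      (K + 2 * (K * K)) * Fintype.card (X ≃ Y) := by
    refine le_trans ?_ (sum_badCount_le a b ha hb hX)
    rw [mul_comm, ← smul_eq_mul]
    refine (Finset.card_nsmul_le_sum _ (badCount a b) _ fun σ hσ => ?_).trans
      (Finset.sum_le_sum_of_subset (Finset.subset_univ _))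
    have := (Finset.mem_filter.1 hσ).2
    omega
  have hsplit := Finset.card_filter_add_card_filter_not (s := (Finset.univ : Finset (X ≃ Y)))
    (fun σ : X ≃ Y => badCount a b σ ≤ B)
  rw [Finset.card_univ] at hsplit
  have hhalf : Fintype.card (X ≃ Y) ≤
      2 * (Finset.univ.filter fun σ : X ≃ Y => badCount a b σ ≤ B).card := by
    have : 2 * (Finset.univ.filter fun σ : X ≃ Y => ¬ badCount a b σ ≤ B).card ≤
        Fintype.card (X ≃ Y) := by
      rcases Nat.eq_zero_or_pos (K + 2 * (K * K)) with h0 | h0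
      · rw [h0] at hmarkov
        have : (Finset.univ.filter fun σ : X ≃ Y => ¬ badCount a b σ ≤ B).card = 0 := by
          nlinarith
        omega
      · refine Nat.le_of_mul_le_mul_left (c := K + 2 * (K * K)) ?_ h0
        nlinarith
    omega
  calc _ ≤ _ := hhalf
    _ ≤ _ := Nat.mul_le_mul_left 2 (hiter B)
    _ = _ := by ring

end Matching


/-! ### From matchings to laws of multigraphs. -/

section Kernels

theorem lintegral_uniformLaw {ι Ω : Type*} [MeasurableSpace Ω] [MeasurableSingletonClass Ω]
    (s : Finset ι) (f : ι → Ω) (g : Ω → ℝ≥0∞) :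
    ∫⁻ ω, g ω ∂(uniformLaw s f) = (s.card : ℝ≥0∞)⁻¹ * ∑ a ∈ s, g (f a) := by
  rw [uniformLaw, lintegral_smul_measure, lintegral_finsetSum_measure]
  simp

open Classical in
theorem uniformLaw_apply {ι Ω : Type*} [MeasurableSpace Ω] [DiscreteMeasurableSpace Ω]
    (s : Finset ι) (f : ι → Ω) (T : Set Ω) :
    uniformLaw s f T = (s.card : ℝ≥0∞)⁻¹ * (s.filter fun a => f a ∈ T).card := by
  simp [uniformLaw, Measure.dirac_apply' _ (MeasurableSet.of_discrete (s := T)),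
    Set.indicator_apply]

theorem card_halfEdge {n : ℕ} (a : Fin n → ℕ) : Fintype.card (HalfEdge a) = ∑ i, a i := by
  simp

theorem card_halfEdge_fst_eq {n : ℕ} (a : Fin n → ℕ) (v : Fin n) :
    (Finset.univ.filter fun h : HalfEdge a => h.1 = v).card = a v := by
  have : (Finset.univ.filter fun h : HalfEdge a => h.1 = v) =
      (Finset.univ : Finset (Fin (a v))).map ⟨Sigma.mk v, sigma_mk_injective⟩ := by
    ext ⟨i, h⟩
    simp only [Finset.mem_filter, Finset.mem_univ, true_and, Finset.mem_map,
      Function.Embedding.coeFn_mk]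
    constructor
    · rintro rfl
      exact ⟨h, rfl⟩
    · rintro ⟨h', e⟩
      exact (congrArg Sigma.fst e).symm
  rw [this, Finset.card_map, Finset.card_univ, Fintype.card_fin]

theorem inDegree_toMultigraph {n : ℕ} {m d : Fin n → ℕ} (σ : HalfEdge m ≃ HalfEdge d)
    (v : Fin n) : inDegree (toMultigraph σ) v = m v := by
  rw [← card_halfEdge_fst_eq m v, Finset.card_eq_sum_card_fiberwise
    (f := fun h : HalfEdge m => (σ h).1) (t := Finset.univ) (by simp)]
  simp [inDegree, toMultigraph, Finset.filter_filter]

theorem outDegree_toMultigraph {n : ℕ} {m d : Fin n → ℕ} (σ : HalfEdge m ≃ HalfEdge d)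
    (v : Fin n) : outDegree (toMultigraph σ) v = d v := by
  have h : (Finset.univ.filter fun h : HalfEdge m => (σ h).1 = v).card = d v := by
    rw [← card_halfEdge_fst_eq d v]
    refine Finset.card_bij (fun x _ => σ x) (by simp) (by simp) fun y hy =>
      ⟨σ.symm y, by simpa using hy, by simp⟩
  rw [← h, Finset.card_eq_sum_card_fiberwise
    (f := fun h : HalfEdge m => h.1) (t := Finset.univ) (by simp)]
  simp [outDegree, toMultigraph, Finset.filter_filter, and_comm]

theorem isSimple_toMultigraph {n : ℕ} {m d : Fin n → ℕ} (σ : HalfEdge m ≃ HalfEdge d)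
    (h : badCount (fun x : HalfEdge m => x.1) (fun y : HalfEdge d => y.1) σ = 0) :
    IsSimple (toMultigraph σ) := by
  classical
  have hbad : ∀ x, ¬ IsBad (fun x : HalfEdge m => x.1) (fun y : HalfEdge d => y.1) σ x := by
    intro x
    have := Finset.filter_eq_empty_iff.1 (Finset.card_eq_zero.1 h)
    exact this (Finset.mem_univ x)
  refine ⟨fun i => ?_, fun i j => ?_⟩
  · rw [toMultigraph, Finset.card_eq_zero, Finset.filter_eq_empty_iff]
    rintro x - ⟨h1, h2⟩
    exact hbad x (Or.inl (h2.trans h1.symm))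
  · rw [toMultigraph, Finset.card_le_one]
    intro x hx y hy
    simp only [Finset.mem_filter, Finset.mem_univ, true_and] at hx hy
    by_contra hxy
    exact hbad x (Or.inr ⟨y, Ne.symm hxy, hy.1.trans hx.1.symm, hy.2.trans hx.2.symm⟩)

theorem inv_card_mul_card_filter_le_one {ι : Type*} (s : Finset ι) (P : ι → Prop)
    [DecidablePred P] : (s.card : ℝ≥0∞)⁻¹ * (s.filter P).card ≤ 1 := by
  calc _ ≤ (s.card : ℝ≥0∞)⁻¹ * s.card := by
        gcongr
        exact Finset.filter_subset _ _
    _ ≤ 1 := ENNReal.inv_mul_le_one _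

theorem configLaw_le_one {n : ℕ} (p : BiSeq n) (T : Set (Multigraph n)) :
    configLaw p T ≤ 1 := by
  classical
  rw [configLaw, uniformLaw_apply]
  exact inv_card_mul_card_filter_le_one _ _

theorem configLaw_eq_zero {n : ℕ} (p : BiSeq n) (T : Set (Multigraph n))
    (h : ∀ σ : HalfEdge p.1 ≃ HalfEdge p.2, toMultigraph σ ∉ T) : configLaw p T = 0 := by
  classical
  rw [configLaw, uniformLaw_apply]
  simp [h]

/-- The probability, starting from the sample `p`, that the multigraph lies in `T`. -/
def graphProb {n : ℕ} (T : Set (Multigraph n)) (p : BiSeq n) : ℝ≥0∞ :=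
  (((Finset.univ : Finset (Fin n)).powersetCard (delta p).natAbs).card : ℝ≥0∞)⁻¹ *
    ∑ A ∈ (Finset.univ : Finset (Fin n)).powersetCard (delta p).natAbs, configLaw (adjust p A) T

/-- Isolates the acceptance probability as a factor that cancels after conditioning on simplicity.
-/
theorem multigraphLaw_apply (F G : PMF ℕ) (α β δ₀ : ℝ) (n : ℕ) (T : Set (Multigraph n)) :
    multigraphLaw F G α β δ₀ n T = (sampleLaw F G n (accept α β δ₀ n))⁻¹ *
      ∫⁻ p in accept α β δ₀ n, graphProb T p ∂(sampleLaw F G n) := by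
  rw [multigraphLaw, Measure.bind_apply .of_discrete Measurable.of_discrete.aemeasurable,
    biDegreeLaw, Measure.lintegral_bind Measurable.of_discrete.aemeasurable
      Measurable.of_discrete.aemeasurable]
  simp only [lintegral_uniformLaw]
  rw [ProbabilityTheory.cond, lintegral_smul_measure]
  rfl

theorem graphProb_le_one {n : ℕ} (T : Set (Multigraph n)) (p : BiSeq n) :
    graphProb T p ≤ 1 := by
  rw [graphProb]
  refine le_trans ?_ (ENNReal.inv_mul_le_one
    (((Finset.univ : Finset (Fin n)).powersetCard (delta p).natAbs).card : ℝ≥0∞))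
  gcongr
  refine (Finset.sum_le_card_nsmul _ _ 1 fun A _ => configLaw_le_one _ _).trans ?_
  simp

/-- The bound by n guarantees that a set of nodes to adjust exists; otherwise the average is over
the empty family and is 0. -/
theorem le_graphProb {n : ℕ} {T : Set (Multigraph n)} {p : BiSeq n} {c : ℝ≥0∞}
    (hp : (delta p).natAbs ≤ n)
    (h : ∀ A : Finset (Fin n), A.card = (delta p).natAbs → c ≤ configLaw (adjust p A) T) :
    c ≤ graphProb T p := by
  have hne : ((Finset.univ : Finset (Fin n)).powersetCard (delta p).natAbs).card ≠ 0 := by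
    rw [Finset.card_powersetCard, Finset.card_univ, Fintype.card_fin]
    exact (Nat.choose_pos hp).ne'
  rw [graphProb]
  calc c = (((Finset.univ : Finset (Fin n)).powersetCard (delta p).natAbs).card : ℝ≥0∞)⁻¹ *
        (((Finset.univ : Finset (Fin n)).powersetCard (delta p).natAbs).card * c) := by
        rw [← mul_assoc, ENNReal.inv_mul_cancel (by exact_mod_cast hne) (by simp), one_mul]
    _ ≤ _ := by
        gcongr
        rw [← nsmul_eq_mul]
        exact Finset.card_nsmul_le_sum _ _ _ fun A hA => h A (Finset.mem_powersetCard.1 hA).2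

theorem graphProb_eq_zero {n : ℕ} {T : Set (Multigraph n)} {p : BiSeq n}
    (h : ∀ A : Finset (Fin n), A.card = (delta p).natAbs → configLaw (adjust p A) T = 0) :
    graphProb T p = 0 := by
  rw [graphProb, Finset.sum_eq_zero fun A hA => h A (Finset.mem_powersetCard.1 hA).2, mul_zero]

theorem sum_adjust_eq {n : ℕ} (p : BiSeq n) (A : Finset (Fin n))
    (hA : A.card = (delta p).natAbs) : ∑ i, (adjust p A).1 i = ∑ i, (adjust p A).2 i := by
  have h1 : ((∑ i, p.1 i : ℕ) : ℤ) - (∑ i, p.2 i : ℕ) = delta p := by simp [delta]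
  rcases lt_or_ge (delta p) 0 with h | h
  · simp only [adjust, Finset.sum_add_distrib, h, h.not_ge, true_and, false_and, if_false]
    simp [Finset.sum_ite_mem, hA]
    omega
  · simp only [adjust, Finset.sum_add_distrib, h, h.not_gt, true_and, false_and, if_false]
    simp [Finset.sum_ite_mem, hA]
    omega

theorem inv_natCast_le_inv_mul {t c D : ℕ} (ht : 0 < t) (h : t ≤ D * c) :
    (D : ℝ≥0∞)⁻¹ ≤ (t : ℝ≥0∞)⁻¹ * c := by
  have hD : (D : ℝ≥0∞) ≠ 0 := by
    rintro h0
    have : D = 0 := by exact_mod_cast h0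
    simp [this] at h
    omega
  have h' : (t : ℝ≥0∞) ≤ D * c := by exact_mod_cast h
  calc (D : ℝ≥0∞)⁻¹ = (D : ℝ≥0∞)⁻¹ * ((t : ℝ≥0∞)⁻¹ * t) := by
        rw [ENNReal.inv_mul_cancel (by exact_mod_cast ht.ne') (by simp), mul_one]
    _ ≤ (D : ℝ≥0∞)⁻¹ * ((t : ℝ≥0∞)⁻¹ * (D * c)) := by gcongr
    _ = ((D : ℝ≥0∞)⁻¹ * D) * ((t : ℝ≥0∞)⁻¹ * c) := by ring
    _ = _ := by rw [ENNReal.inv_mul_cancel hD (by simp), one_mul]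

theorem le_configLaw_isSimple {n K : ℕ} (p : BiSeq n) (h₁ : ∀ i, p.1 i ≤ K)
    (h₂ : ∀ i, p.2 i ≤ K) (hsum : ∑ i, p.1 i = ∑ i, p.2 i) (h2 : 2 ≤ ∑ i, p.1 i)
    (hK : 2 * K + 2 * (K * K) < ∑ i, p.1 i) :
    ((2 * ((K * n) ^ 2) ^ (2 * (K + 2 * (K * K))) : ℕ) : ℝ≥0∞)⁻¹ ≤
      configLaw p {E | IsSimple E} := by
  have hc₁ : ∀ v, (Finset.univ.filter fun x : HalfEdge p.1 => x.1 = v).card ≤ K := fun v =>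
    (card_halfEdge_fst_eq p.1 v).trans_le (h₁ v)
  have hc₂ : ∀ v, (Finset.univ.filter fun x : HalfEdge p.2 => x.1 = v).card ≤ K := fun v =>
    (card_halfEdge_fst_eq p.2 v).trans_le (h₂ v)
  have hcomb := card_equiv_le_card_badCount_eq_zero (K := K) (fun x : HalfEdge p.1 => x.1)
    (fun y : HalfEdge p.2 => y.1) (by convert hc₁) (by convert hc₂)
    (by rw [card_halfEdge]; exact h2) (by rw [card_halfEdge]; exact hK)
  have hM : Fintype.card (HalfEdge p.1) ≤ K * n := by
    rw [card_halfEdge]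
    calc _ ≤ ∑ i : Fin n, K := Finset.sum_le_sum fun i _ => h₁ i
      _ = _ := by simp [mul_comm]
  -- Equal totals ensure that there is a matching at all, so the uniform law is not the zero
  -- measure.
  have hT : 0 < Fintype.card (HalfEdge p.1 ≃ HalfEdge p.2) := by
    rw [Fintype.card_equiv (Fintype.equivOfCardEq
      (by rw [card_halfEdge, card_halfEdge, hsum]))]
    exact Nat.factorial_pos _
  have hD := hcomb.trans (Nat.mul_le_mul_right _ (Nat.mul_le_mul_left 2
    (Nat.pow_le_pow_left (Nat.pow_le_pow_left hM 2) (2 * (K + 2 * (K * K))))))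
  generalize 2 * ((K * n) ^ 2) ^ (2 * (K + 2 * (K * K))) = D at hD ⊢
  rw [configLaw, uniformLaw_apply, Finset.card_univ]
  classical
  refine inv_natCast_le_inv_mul hT (hD.trans (Nat.mul_le_mul_left _ (Finset.card_le_card ?_)))
  intro σ hσ
  rw [Finset.mem_filter] at hσ ⊢
  exact ⟨hσ.1, isSimple_toMultigraph σ hσ.2⟩

end Kernels


/-! ### Change of measure and Hoeffding's inequality. -/

section Sampling

/-- A distribution on `ℕ` with finite mean is dominated from below, up to a factor close to one, by
a boundedly supported distribution with the same mean. -/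
theorem exists_bounded_pmf_of_mean (F : PMF ℕ) {μ : ℝ}
    (hF : HasSum (fun k : ℕ => (k : ℝ) * (F k).toReal) μ) {c : ℝ} (hc : 1 < c) :
    ∃ (F' : PMF ℕ) (K : ℕ), (∀ k, F' k ≠ 0 → k ≤ K) ∧
      HasSum (fun k : ℕ => (k : ℝ) * (F' k).toReal) μ ∧
      ∀ k, F' k ≤ ENNReal.ofReal c * F k := by
  -- If no atom lies above the mean, F is already bounded. Otherwise an atom a > μ serves to restore
  -- the mean lost by truncation.
  by_cases hbdd : ∀ a : ℕ, F a ≠ 0 → (a : ℝ) ≤ μ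
  · refine ⟨F, ⌈μ⌉₊, fun k hk => ?_, hF, fun k => ?_⟩
    · exact_mod_cast (hbdd k hk).trans (Nat.le_ceil μ)
    · exact le_mul_of_one_le_left' (by simpa using hc.le)
  push Not at hbdd
  obtain ⟨a, ha0, haμ⟩ := hbdd
  set f : ℕ → ℝ := fun k => (F k).toReal
  have hf0 : ∀ k, 0 ≤ f k := fun k => ENNReal.toReal_nonneg
  have hfa : 0 < f a := ENNReal.toReal_pos ha0 (F.apply_ne_top a)
  have hsum1 : HasSum f 1 := by
    have h := ENNReal.hasSum_toReal (f := F) (by simp [F.tsum_coe])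
    rwa [← ENNReal.tsum_toReal_eq F.apply_ne_top, F.tsum_coe, ENNReal.toReal_one] at h
  set Z : ℕ → ℝ := fun K => ∑ k ∈ Finset.range K, f k
  set S : ℕ → ℝ := fun K => ∑ k ∈ Finset.range K, (k : ℝ) * f k
  have hZ : Tendsto Z atTop (𝓝 1) := hsum1.tendsto_sum_nat
  have hS : Tendsto S atTop (𝓝 μ) := hF.tendsto_sum_nat
  -- The new law is s·F restricted to k < K plus mass r at a, where sZ + r = 1 and sS + ra = μ.
  -- Cramer's rule gives s and r with determinant Za - S, and s → 1, r → 0 as K grows.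
  have hd : Tendsto (fun K => Z K * a - S K) atTop (𝓝 (a - μ)) := by
    simpa using (hZ.mul_const (a : ℝ)).sub hS
  have haμ' : 0 < (a : ℝ) - μ := sub_pos.2 haμ
  have hs : Tendsto (fun K => (a - μ) / (Z K * a - S K)) atTop (𝓝 1) := by
    have := (tendsto_const_nhds (x := (a : ℝ) - μ)).div hd haμ'.ne'
    rwa [div_self haμ'.ne'] at this
  have hr : Tendsto (fun K => (Z K * μ - S K) / (Z K * a - S K)) atTop (𝓝 0) := by
    have := ((hZ.mul_const μ).sub hS).div hd haμ'.ne'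
    rwa [one_mul, sub_self, zero_div] at this
  have hsr : Tendsto (fun K => (a - μ) / (Z K * a - S K) +
      (Z K * μ - S K) / (Z K * a - S K) / f a) atTop (𝓝 1) := by
    simpa using hs.add (hr.div_const (f a))
  obtain ⟨K, hKa, hKμ, hKd, hKs, hKsr⟩ : ∃ K : ℕ, a < K ∧ μ ≤ K ∧ 0 < Z K * a - S K ∧
      (a - μ) / (Z K * a - S K) < c ∧
      (a - μ) / (Z K * a - S K) + (Z K * μ - S K) / (Z K * a - S K) / f a < c :=
    ((eventually_gt_atTop a).and ((eventually_ge_atTop ⌈μ⌉₊).mono (fun K hK =>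
      (Nat.le_ceil μ).trans (by exact_mod_cast hK)) |>.and
      ((hd.eventually_const_lt haμ').and ((hs.eventually_lt_const hc).and
        (hsr.eventually_lt_const hc))))).exists
  -- Since K ≥ μ, the terms (k - μ) f k removed by truncation are nonnegative, while the full series
  -- sums to 0.
  have hr0 : 0 ≤ Z K * μ - S K := by
    have h0 : HasSum (fun k : ℕ => (k : ℝ) * f k - μ * f k) 0 := by
      simpa using hF.sub (hsum1.mul_left μ)
    have := sum_le_hasSum (Finset.range K) (fun k hk => by
      have hkK : (K : ℝ) ≤ k := by simpa using hk
      rw [← sub_mul]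
      exact mul_nonneg (by linarith) (hf0 k)) h0
    rw [Finset.sum_sub_distrib, ← Finset.mul_sum] at this
    simp only [Z, S]
    linarith
  set d := Z K * a - S K
  set s := (a - μ) / d
  set r := (Z K * μ - S K) / d
  have hs0 : 0 ≤ s := div_nonneg haμ'.le hKd.le
  have hr0' : 0 ≤ r := div_nonneg hr0 hKd.le
  have hsd : s * d = a - μ := div_mul_cancel₀ _ hKd.ne'
  have hrd : r * d = Z K * μ - S K := div_mul_cancel₀ _ hKd.ne'
  have htot : s * Z K + r = 1 := by
    refine mul_right_cancel₀ hKd.ne' ?_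
    calc (s * Z K + r) * d = (s * d) * Z K + r * d := by ring
      _ = (a - μ) * Z K + (Z K * μ - S K) := by rw [hsd, hrd]
      _ = 1 * d := by simp only [d]; ring
  have hmean : s * S K + r * a = μ := by
    refine mul_right_cancel₀ hKd.ne' ?_
    calc (s * S K + r * a) * d = (s * d) * S K + (r * d) * a := by ring
      _ = (a - μ) * S K + (Z K * μ - S K) * a := by rw [hsd, hrd]
      _ = μ * d := by simp only [d]; ring
  let w : ℕ → ℝ := fun k => if k < K then s * f k + (if k = a then r else 0) else 0
  have hw0 : ∀ k, 0 ≤ w k := by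
    intro k
    have := mul_nonneg hs0 (hf0 k)
    simp only [w]
    split_ifs <;> linarith
  have haK : a ∈ Finset.range K := Finset.mem_range.2 hKa
  have hwsum : ∑ k ∈ Finset.range K, w k = 1 := by
    rw [← htot, Finset.sum_congr rfl fun k hk => if_pos (Finset.mem_range.1 hk),
      Finset.sum_add_distrib, ← Finset.mul_sum, Finset.sum_ite_eq' _ a, if_pos haK]
  have hwmean : ∑ k ∈ Finset.range K, (k : ℝ) * w k = μ := by
    have : ∀ k ∈ Finset.range K, (k : ℝ) * w k =
        s * (k * f k) + (if k = a then (k : ℝ) * r else 0) := by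
      intro k hk
      simp only [w, if_pos (Finset.mem_range.1 hk)]
      split_ifs <;> ring
    rw [Finset.sum_congr rfl this, Finset.sum_add_distrib, ← Finset.mul_sum,
      Finset.sum_ite_eq' _ a, if_pos haK, ← hmean]
    ring
  refine ⟨PMF.ofFinset (fun k => ENNReal.ofReal (w k)) (Finset.range K) ?_ ?_, K, ?_, ?_, ?_⟩
  · rw [← ENNReal.ofReal_sum_of_nonneg fun k _ => hw0 k, hwsum, ENNReal.ofReal_one]
  · intro k hk
    have : ¬ k < K := by simpa using hk
    simp [w, this]
  · intro k hk
    by_contra h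
    have : ¬ k < K := by omega
    simp [w, this] at hk
  · simp only [PMF.ofFinset_apply, ENNReal.toReal_ofReal (hw0 _)]
    rw [← hwmean]
    refine hasSum_sum_of_ne_finset_zero fun k hk => ?_
    have : ¬ k < K := by simpa using hk
    simp [w, this]
  · intro k
    rw [PMF.ofFinset_apply, ← ENNReal.ofReal_toReal (F.apply_ne_top k),
      ← ENNReal.ofReal_mul (by linarith)]
    refine ENNReal.ofReal_le_ofReal ?_
    change w k ≤ c * f k
    have hcf : 0 ≤ c * f k := mul_nonneg (by linarith) (hf0 k)
    simp only [w]
    split_ifs with h1 h2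
    · subst h2
      have : s * f k + r = (s + r / f k) * f k := by field_simp
      rw [this]
      exact mul_le_mul_of_nonneg_right hKsr.le (hf0 k)
    · rw [add_zero]
      exact mul_le_mul_of_nonneg_right hKs.le (hf0 k)
    · exact hcf

theorem sampleLaw_singleton (F G : PMF ℕ) (n : ℕ) (p : BiSeq n) :
    sampleLaw F G n {p} = (∏ i, F (p.1 i)) * ∏ i, G (p.2 i) := by
  obtain ⟨x, y⟩ := p
  rw [sampleLaw, ← Set.singleton_prod_singleton, Measure.prod_prod, Measure.pi_singleton,
    Measure.pi_singleton]
  simp [PMF.toMeasure_apply_singleton]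

/-- The point masses are products over 2n draws, each costing a factor c. -/
theorem sampleLaw_le_of_le (F G F' G' : PMF ℕ) {c : ℝ≥0∞} (hF : ∀ k, F' k ≤ c * F k)
    (hG : ∀ k, G' k ≤ c * G k) (n : ℕ) (A : Set (BiSeq n)) :
    sampleLaw F' G' n A ≤ c ^ (2 * n) * sampleLaw F G n A := by
  rw [← Measure.tsum_indicator_apply_singleton (sampleLaw F' G' n) A .of_discrete,
    ← Measure.tsum_indicator_apply_singleton (sampleLaw F G n) A .of_discrete,
    ← ENNReal.tsum_mul_left]
  refine ENNReal.tsum_le_tsum fun p => ?_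
  by_cases hp : p ∈ A
  · simp only [Set.indicator_of_mem hp, sampleLaw_singleton]
    calc _ ≤ (∏ i, c * F (p.1 i)) * ∏ i, c * G (p.2 i) :=
          mul_le_mul' (Finset.prod_le_prod' fun i _ => hF _) (Finset.prod_le_prod' fun i _ => hG _)
      _ = _ := by
          simp only [Finset.prod_mul_distrib, Finset.prod_const, Finset.card_univ,
            Fintype.card_fin]
          ring
  · simp [Set.indicator_of_notMem hp]

instance isProbabilityMeasure_sampleLaw (F G : PMF ℕ) (n : ℕ) :
    IsProbabilityMeasure (sampleLaw F G n) := by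
  unfold sampleLaw
  infer_instance

theorem ae_prod_pmf (F G : PMF ℕ) {P : ℕ × ℕ → Prop}
    (h : ∀ x y, F x ≠ 0 → G y ≠ 0 → P (x, y)) :
    ∀ᵐ q ∂(F.toMeasure.prod G.toMeasure), P q := by
  rw [ae_iff_of_countable]
  rintro ⟨x, y⟩ hq
  rw [← Set.singleton_prod_singleton, Measure.prod_prod,
    PMF.toMeasure_apply_singleton _ _ (measurableSet_singleton _),
    PMF.toMeasure_apply_singleton _ _ (measurableSet_singleton _)] at hq
  exact h x y (left_ne_zero_of_mul hq) (right_ne_zero_of_mul hq)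

/-- One-sided Hoeffding for the i.i.d. pairs at the nodes. The bound on φ is asked only on the
supports, so that it applies to unbounded φ when the laws are bounded. -/
theorem sampleLaw_sum_ge_le (F G : PMF ℕ) (φ : ℕ × ℕ → ℝ) {c : ℝ}
    (hφ : ∀ x y, F x ≠ 0 → G y ≠ 0 → |φ (x, y)| ≤ c) (n : ℕ) {t : ℝ} (ht : 0 ≤ t) :
    sampleLaw F G n {p | t ≤ (∑ i, φ (p.1 i, p.2 i)) -
        n * ∫ q, φ q ∂(F.toMeasure.prod G.toMeasure)} ≤
      ENNReal.ofReal (Real.exp (-t ^ 2 / (2 * (n * c ^ 2)))) := by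
  set ρ := F.toMeasure.prod G.toMeasure
  set m := ∫ q, φ q ∂ρ
  have hsub : HasSubgaussianMGF (fun q => φ q - m) ((‖c - (-c)‖₊ / 2) ^ 2) ρ :=
    hasSubgaussianMGF_of_mem_Icc Measurable.of_discrete.aemeasurable
      (ae_prod_pmf F G fun x y hx hy => abs_le.1 (hφ x y hx hy))
  have hind : iIndepFun (fun (i : Fin n) (ω : Fin n → ℕ × ℕ) => φ (ω i) - m)
      (Measure.pi fun _ : Fin n => ρ) :=
    iIndepFun_pi (X := fun _ q => φ q - m) fun _ => Measurable.of_discrete.aemeasurable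
  have hsub' : ∀ i ∈ (Finset.univ : Finset (Fin n)),
      HasSubgaussianMGF (fun ω : Fin n → ℕ × ℕ => φ (ω i) - m) ((‖c - (-c)‖₊ / 2) ^ 2)
        (Measure.pi fun _ : Fin n => ρ) := by
    intro i _
    have hmp := measurePreserving_eval (fun _ : Fin n => ρ) i
    refine HasSubgaussianMGF.of_map (Y := fun ω : Fin n → ℕ × ℕ => ω i)
      (X := fun q => φ q - m) hmp.measurable.aemeasurable ?_
    rw [show (fun ω : Fin n → ℕ × ℕ => ω i) = Function.eval i from rfl, hmp.map_eq]
    exact hsub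
  have hmain := HasSubgaussianMGF.measure_sum_ge_le_of_iIndepFun hind hsub' ht
  -- Hoeffding was applied to a sequence of pairs; `sampleLaw` is a pair of sequences.
  have hmp := measurePreserving_arrowProdEquivProdArrow ℕ ℕ (Fin n) (fun _ => F.toMeasure)
    (fun _ => G.toMeasure)
  have hc : ((∑ i : Fin n, (‖c - (-c)‖₊ / 2) ^ 2 : NNReal) : ℝ) = n * c ^ 2 := by
    have : |c + c| / 2 = |c| := by
      rw [← two_mul, abs_mul, abs_two, mul_div_cancel_left₀ _ two_ne_zero]
    simp [this]
  rw [hc] at hmain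
  rw [sampleLaw, ← hmp.measure_preimage (MeasurableSet.of_discrete.nullMeasurableSet),
    ← ofReal_measureReal]
  refine ENNReal.ofReal_le_ofReal (le_trans (le_of_eq ?_) hmain)
  congr 1
  ext ω
  simp [MeasurableEquiv.arrowProdEquivProdArrow, Equiv.arrowProdEquivProdArrow,
    Finset.sum_sub_distrib]

/-- Hoeffding's inequality for sums over the nodes of a function of the sampled pairs. -/
theorem sampleLaw_abs_sum_ge_le (F G : PMF ℕ) (φ : ℕ × ℕ → ℝ) {c : ℝ}
    (hφ : ∀ x y, F x ≠ 0 → G y ≠ 0 → |φ (x, y)| ≤ c) (n : ℕ) {t : ℝ} (ht : 0 ≤ t) :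
    sampleLaw F G n {p | t ≤ |(∑ i, φ (p.1 i, p.2 i)) -
        n * ∫ q, φ q ∂(F.toMeasure.prod G.toMeasure)|} ≤
      ENNReal.ofReal (2 * Real.exp (-t ^ 2 / (2 * (n * c ^ 2)))) := by
  have h₁ := sampleLaw_sum_ge_le F G φ hφ n ht
  have h₂ := sampleLaw_sum_ge_le F G (fun q => -φ q) (c := c)
    (fun x y hx hy => by simpa using hφ x y hx hy) n ht
  rw [two_mul, ENNReal.ofReal_add (Real.exp_nonneg _) (Real.exp_nonneg _)]
  refine le_trans (measure_mono ?_) ((measure_union_le _ _).trans (add_le_add h₁ h₂))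
  intro p hp
  simp only [Set.mem_ofPred_eq, Set.mem_union, integral_neg, Finset.sum_neg_distrib] at hp ⊢
  rcases le_abs.1 hp with h | h
  · exact Or.inl h
  · exact Or.inr (by linarith)

end Sampling


/-! ### Simple graphs are not exponentially unlikely. -/

section SimpleLowerBound

theorem ae_pmf (F : PMF ℕ) {P : ℕ → Prop} (h : ∀ x, F x ≠ 0 → P x) :
    ∀ᵐ x ∂F.toMeasure, P x := by
  rw [ae_iff_of_countable]
  intro x hx
  rw [PMF.toMeasure_apply_singleton _ _ (measurableSet_singleton _)] at hx
  exact h x hx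

theorem integrable_natCast_of_bounded (F : PMF ℕ) {K : ℕ} (hK : ∀ k, F k ≠ 0 → k ≤ K) :
    Integrable (fun k : ℕ => (k : ℝ)) F.toMeasure :=
  Integrable.of_mem_Icc 0 K Measurable.of_discrete.aemeasurable
    (ae_pmf F fun k hk => ⟨Nat.cast_nonneg k, by exact_mod_cast hK k hk⟩)

theorem integral_natCast_of_bounded (F : PMF ℕ) {K : ℕ} (hK : ∀ k, F k ≠ 0 → k ≤ K) {μ : ℝ}
    (hF : HasSum (fun k : ℕ => (k : ℝ) * (F k).toReal) μ) :
    ∫ k : ℕ, (k : ℝ) ∂F.toMeasure = μ := by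
  rw [PMF.integral_eq_tsum _ _ (integrable_natCast_of_bounded F hK), ← hF.tsum_eq]
  simp [mul_comm]

/-- The exponent equals -a² n^(2e-1) / (2c²), which is where e > 1/2 enters. -/
theorem tendsto_hoeffding_bound {a e c : ℝ} (ha : 0 < a) (he : 1 / 2 < e) (hc : 0 < c) :
    Tendsto (fun n : ℕ => ENNReal.ofReal
      (2 * Real.exp (-(a * (n : ℝ) ^ e) ^ 2 / (2 * (n * c ^ 2))))) atTop (𝓝 0) := by
  have h1 : Tendsto (fun n : ℕ => a ^ 2 / (2 * c ^ 2) * (n : ℝ) ^ (2 * e - 1)) atTop atTop :=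
    ((tendsto_rpow_atTop (by linarith)).comp tendsto_natCast_atTop_atTop).const_mul_atTop
      (by positivity)
  have h2 := (Real.tendsto_exp_neg_atTop_nhds_zero.comp h1).const_mul 2
  rw [mul_zero] at h2
  have h3 := ENNReal.tendsto_ofReal h2
  rw [ENNReal.ofReal_zero] at h3
  refine h3.congr' ?_
  filter_upwards [eventually_gt_atTop 0] with n hn
  have hn' : (0 : ℝ) < n := by exact_mod_cast hn
  simp only [Function.comp]
  congr 3
  rw [Real.rpow_sub hn', Real.rpow_one, mul_comm 2 e, Real.rpow_mul hn'.le]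
  simp only [Real.rpow_ofNat]
  field_simp

theorem eventually_const_mul_pow_le_exp (C : ℝ) (hC : 0 < C) (k : ℕ) {b : ℝ} (hb : 0 < b) :
    ∀ᶠ n : ℕ in atTop, C * (n : ℝ) ^ k ≤ Real.exp (b * n) := by
  have := (isLittleO_pow_exp_pos_mul_atTop k hb).def (inv_pos.2 hC)
  filter_upwards [tendsto_natCast_atTop_atTop.eventually this] with n hn
  rw [Real.norm_of_nonneg (by positivity), Real.norm_of_nonneg (Real.exp_nonneg _)] at hn
  calc C * (n : ℝ) ^ k ≤ C * (C⁻¹ * Real.exp (b * n)) := by gcongr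
    _ = _ := by rw [mul_inv_cancel_left₀ hC.ne']

theorem ae_sampleLaw_ne_zero (F G : PMF ℕ) (n : ℕ) :
    ∀ᵐ p ∂(sampleLaw F G n), ∀ i, F (p.1 i) ≠ 0 ∧ G (p.2 i) ≠ 0 := by
  rw [ae_iff_of_countable]
  intro p hp i
  rw [sampleLaw_singleton] at hp
  exact ⟨Finset.prod_ne_zero_iff.1 (left_ne_zero_of_mul hp) i (Finset.mem_univ i),
    Finset.prod_ne_zero_iff.1 (right_ne_zero_of_mul hp) i (Finset.mem_univ i)⟩

/-- The samples with all degrees at most `K` whose imbalance is accepted and whose total in-degree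
is not too small. -/
def tameSamples (α β δ₀ μ : ℝ) (K n : ℕ) : Set (BiSeq n) :=
  accept α β δ₀ n ∩ {p | (∀ i, p.1 i ≤ K ∧ p.2 i ≤ K) ∧ n * (μ / 2) ≤ ∑ i, (p.1 i : ℝ)}

theorem eventually_half_le_sampleLaw (F G : PMF ℕ) {μ α β δ₀ : ℝ} {K : ℕ} (hμ : 0 < μ)
    (hF : HasSum (fun k : ℕ => (k : ℝ) * (F k).toReal) μ)
    (hG : HasSum (fun k : ℕ => (k : ℝ) * (G k).toReal) μ)
    (hFK : ∀ k, F k ≠ 0 → k ≤ K) (hGK : ∀ k, G k ≠ 0 → k ≤ K)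
    (he : 1 / 2 < 1 - kappa α β + δ₀) :
    ∀ᶠ n : ℕ in atTop, 2⁻¹ ≤ sampleLaw F G n (tameSamples α β δ₀ μ K n) := by
  set e := 1 - kappa α β + δ₀
  -- One bound for the imbalance at scale n^e, one for the total in-degree at scale n. Using K + 1
  -- as the range makes its positivity immediate.
  have hlim := (tendsto_hoeffding_bound one_pos he (Nat.cast_add_one_pos K)).add
    (tendsto_hoeffding_bound (half_pos hμ) (by norm_num : (1 : ℝ) / 2 < 1)
      (Nat.cast_add_one_pos (α := ℝ) K))
  rw [add_zero] at hlim
  filter_upwards [hlim.eventually_le_const (by simp : (0 : ℝ≥0∞) < 2⁻¹)] with n hn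
  have hintF := integrable_natCast_of_bounded F hFK
  have hintG := integrable_natCast_of_bounded G hGK
  have hmean1 : ∫ q : ℕ × ℕ, (q.1 : ℝ) ∂(F.toMeasure.prod G.toMeasure) = μ := by
    rw [integral_fun_fst (fun k : ℕ => (k : ℝ)), integral_natCast_of_bounded F hFK hF]
    simp
  have hmean2 : ∫ q : ℕ × ℕ, (q.2 : ℝ) ∂(F.toMeasure.prod G.toMeasure) = μ := by
    rw [integral_fun_snd (fun k : ℕ => (k : ℝ)), integral_natCast_of_bounded G hGK hG]
    simp
  have hmean : ∫ q : ℕ × ℕ, ((q.1 : ℝ) - q.2) ∂(F.toMeasure.prod G.toMeasure) = 0 := by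
    rw [integral_sub (hintF.comp_fst G.toMeasure) (hintG.comp_snd F.toMeasure), hmean1, hmean2,
      sub_self]
  have h₁ := sampleLaw_abs_sum_ge_le F G (fun q => (q.1 : ℝ) - q.2) (c := K + 1)
    (fun x y hx hy => by
      have hx' : (x : ℝ) ≤ K := by exact_mod_cast hFK x hx
      have hy' : (y : ℝ) ≤ K := by exact_mod_cast hGK y hy
      have hx0 : (0 : ℝ) ≤ x := Nat.cast_nonneg x
      have hy0 : (0 : ℝ) ≤ y := Nat.cast_nonneg y
      exact abs_le.2 ⟨by linarith, by linarith⟩) n (t := 1 * (n : ℝ) ^ e) (by positivity)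
  have h₂ := sampleLaw_abs_sum_ge_le F G (fun q => (q.1 : ℝ)) (c := K + 1)
    (fun x y hx hy => by
      have hx' : (x : ℝ) ≤ K := by exact_mod_cast hFK x hx
      have hx0 : (0 : ℝ) ≤ x := Nat.cast_nonneg x
      exact abs_le.2 ⟨by linarith, by linarith⟩) n (t := μ / 2 * (n : ℝ) ^ (1 : ℝ))
      (by positivity)
  rw [hmean] at h₁
  rw [hmean1] at h₂
  have hae := ae_sampleLaw_ne_zero F G n
  rw [ae_iff] at hae
  have hcompl : sampleLaw F G n (tameSamples α β δ₀ μ K n)ᶜ ≤ 2⁻¹ := by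
    refine le_trans (measure_mono ?_) ((measure_union_le _ _).trans
      ((add_le_add ((measure_union_le _ _).trans (add_le_add h₁ h₂)) hae.le).trans
        ((add_zero _).trans_le hn)))
    intro p hp
    by_contra hcon
    simp only [Set.mem_union, Set.mem_ofPred_eq, not_or, not_not, not_le, mul_zero, sub_zero,
      one_mul, Real.rpow_one] at hcon
    obtain ⟨⟨c1, c2⟩, c3⟩ := hcon
    refine hp ⟨?_, fun i => ⟨hFK _ (c3 i).1, hGK _ (c3 i).2⟩, ?_⟩
    · rw [accept, Set.mem_ofPred_eq, delta]
      push_cast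
      rw [← Finset.sum_sub_distrib]
      exact c1.le
    · have := (abs_lt.1 c2).1
      linarith
  have htotal : (1 : ℝ≥0∞) ≤ sampleLaw F G n (tameSamples α β δ₀ μ K n) + 2⁻¹ := by
    rw [← prob_add_prob_compl (μ := sampleLaw F G n)
      (.of_discrete : MeasurableSet (tameSamples α β δ₀ μ K n))]
    gcongr
  rw [← ENNReal.inv_two_add_inv_two] at htotal
  exact (ENNReal.add_le_add_iff_right (by simp)).1 htotal

theorem natAbs_delta_le {α β δ₀ : ℝ} {n : ℕ} (hn : 1 ≤ n) (he : 1 - kappa α β + δ₀ < 1)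
    {p : BiSeq n} (hp : p ∈ accept α β δ₀ n) : (delta p).natAbs ≤ n := by
  have h1 : (1 : ℝ) ≤ n := by exact_mod_cast hn
  have h2 : |(delta p : ℝ)| ≤ n := by
    refine le_trans hp ?_
    calc (n : ℝ) ^ (1 - kappa α β + δ₀) ≤ (n : ℝ) ^ (1 : ℝ) :=
          Real.rpow_le_rpow_of_exponent_le h1 he.le
      _ = n := Real.rpow_one _
  have h3 : |delta p| ≤ (n : ℤ) := by exact_mod_cast h2
  rw [Int.abs_eq_natAbs] at h3
  exact_mod_cast h3

/-- The switching bound applies with K + 1, since the adjustment may raise a degree by one; the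
total in-degree grows linearly and so exceeds the threshold depending on K. -/
theorem eventually_le_graphProb_isSimple {α β δ₀ μ : ℝ} (hμ : 0 < μ) (K : ℕ)
    (he : 1 - kappa α β + δ₀ < 1) :
    ∀ᶠ n : ℕ in atTop, ∀ p ∈ tameSamples α β δ₀ μ K n,
      ((2 * (((K + 1) * n) ^ 2) ^ (2 * ((K + 1) + 2 * ((K + 1) * (K + 1)))) : ℕ) : ℝ≥0∞)⁻¹ ≤
        graphProb {E | IsSimple E} p := by
  have hlarge : Tendsto (fun n : ℕ => (n : ℝ) * (μ / 2)) atTop atTop :=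
    tendsto_natCast_atTop_atTop.atTop_mul_const (half_pos hμ)
  filter_upwards [hlarge.eventually_gt_atTop
    ((2 * (K + 1) + 2 * ((K + 1) * (K + 1)) : ℕ) : ℝ), eventually_ge_atTop 1] with n hn hn1 p hp
  obtain ⟨hacc, hK, hsum⟩ := hp
  have hsum' : 2 * (K + 1) + 2 * ((K + 1) * (K + 1)) < ∑ i, p.1 i := by
    have := hn.trans_le hsum
    exact_mod_cast this
  refine le_graphProb (natAbs_delta_le hn1 he hacc) fun A hA => ?_
  have hge : ∑ i, p.1 i ≤ ∑ i, (adjust p A).1 i :=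
    Finset.sum_le_sum fun i _ => Nat.le_add_right _ _
  refine le_configLaw_isSimple _ (fun i => ?_) (fun i => ?_) (sum_adjust_eq p A hA) ?_
    (hsum'.trans_le hge)
  · have := (hK i).1
    simp only [adjust]
    split_ifs <;> omega
  · have := (hK i).2
    simp only [adjust]
    split_ifs <;> omega
  · omega

/-- Accepting the sample and then obtaining a simple graph is not exponentially unlikely. -/
theorem eventually_exp_le_lintegral_isSimple (F G : PMF ℕ) {μ α β δ₀ : ℝ} (hμ : 0 < μ)
    (hF : HasSum (fun k : ℕ => (k : ℝ) * (F k).toReal) μ)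
    (hG : HasSum (fun k : ℕ => (k : ℝ) * (G k).toReal) μ)
    (he₁ : 1 / 2 < 1 - kappa α β + δ₀) (he₂ : 1 - kappa α β + δ₀ < 1) {η : ℝ} (hη : 0 < η) :
    ∀ᶠ n : ℕ in atTop, ENNReal.ofReal (Real.exp (-η * n)) ≤
      ∫⁻ p in accept α β δ₀ n, graphProb {E | IsSimple E} p ∂(sampleLaw F G n) := by
  -- Then c^(2n) = exp(ηn/2); the remaining exp(ηn/2) absorbs the polynomial cost of simplicity and
  -- the factor 2.
  have hc : 1 < Real.exp (η / 4) := Real.one_lt_exp_iff.2 (by positivity)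
  obtain ⟨F', K₁, hFK, hF', hFF⟩ := exists_bounded_pmf_of_mean F hF hc
  obtain ⟨G', K₂, hGK, hG', hGG⟩ := exists_bounded_pmf_of_mean G hG hc
  set K := max K₁ K₂
  set m := 2 * ((K + 1) + 2 * ((K + 1) * (K + 1)))
  filter_upwards [eventually_half_le_sampleLaw (K := K) F' G' hμ hF' hG'
      (fun k hk => (hFK k hk).trans (le_max_left _ _))
      (fun k hk => (hGK k hk).trans (le_max_right _ _)) he₁,
    eventually_le_graphProb_isSimple hμ K he₂,
    eventually_const_mul_pow_le_exp (2 * (2 * ((K + 1 : ℝ) ^ 2) ^ m)) (by positivity) (2 * m)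
      (half_pos hη), eventually_ge_atTop 1] with n h₁ h₂ h₃ hn
  have hA := h₁.trans (sampleLaw_le_of_le F G F' G' hFF hGG n (tameSamples α β δ₀ μ K n))
  set P := sampleLaw F G n (tameSamples α β δ₀ μ K n)
  have hPtop : P ≠ ∞ := measure_ne_top _ _
  set D : ℕ := 2 * (((K + 1) * n) ^ 2) ^ m with hD_def
  have hlow : (D : ℝ≥0∞)⁻¹ * P ≤
      ∫⁻ p in accept α β δ₀ n, graphProb {E | IsSimple E} p ∂(sampleLaw F G n) := by
    calc (D : ℝ≥0∞)⁻¹ * P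
        = ∫⁻ _ in tameSamples α β δ₀ μ K n, (D : ℝ≥0∞)⁻¹ ∂(sampleLaw F G n) := by
          rw [setLIntegral_const]
      _ ≤ ∫⁻ p in tameSamples α β δ₀ μ K n, graphProb {E | IsSimple E} p ∂(sampleLaw F G n) :=
          setLIntegral_mono' .of_discrete h₂
      _ ≤ _ := lintegral_mono_set Set.inter_subset_left
  refine le_trans ?_ hlow
  have hD : (0 : ℝ) < D := by
    have : 0 < D := by
      have : 0 < n := hn
      simp only [hD_def]
      positivity
    exact_mod_cast this
  have hDexp : 2 * (D : ℝ) ≤ Real.exp (η / 2 * n) := by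
    refine le_trans (le_of_eq ?_) h₃
    simp only [hD_def]
    push_cast
    rw [mul_pow, mul_pow, pow_mul (n : ℝ) 2 m]
    ring
  have hPreal : 2⁻¹ ≤ Real.exp (η / 2 * n) * P.toReal := by
    have h := ENNReal.toReal_mono (by finiteness) hA
    rw [ENNReal.toReal_mul, ENNReal.toReal_pow, ENNReal.toReal_ofReal (Real.exp_nonneg _),
      ← Real.exp_nat_mul, ENNReal.toReal_inv, ENNReal.toReal_ofNat] at h
    convert h using 3
    push_cast
    ring
  rw [← ENNReal.ofReal_toReal hPtop, ← ENNReal.ofReal_natCast, ← ENNReal.ofReal_inv_of_pos hD,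
    ← ENNReal.ofReal_mul (by positivity)]
  refine ENNReal.ofReal_le_ofReal ?_
  rw [inv_mul_eq_div, le_div_iff₀ hD]
  have hx : 0 < Real.exp (-η * n) := Real.exp_pos _
  have hprod : Real.exp (-η * n) * Real.exp (η / 2 * n) * Real.exp (η / 2 * n) = 1 := by
    rw [← Real.exp_add, ← Real.exp_add, ← Real.exp_zero]
    congr 1
    ring
  have hy : 0 < Real.exp (η / 2 * n) := Real.exp_pos _
  calc Real.exp (-η * n) * D ≤ Real.exp (-η * n) * (Real.exp (η / 2 * n) / 2) := by
        gcongr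
        linarith
    _ = Real.exp (-η * n) * Real.exp (η / 2 * n) * 2⁻¹ := by ring
    _ ≤ Real.exp (-η * n) * Real.exp (η / 2 * n) * (Real.exp (η / 2 * n) * P.toReal) := by
        gcongr
    _ = (Real.exp (-η * n) * Real.exp (η / 2 * n) * Real.exp (η / 2 * n)) * P.toReal := by ring
    _ = P.toReal := by rw [hprod, one_mul]

end SimpleLowerBound


/-! ### Empirical degrees and the conditional law. -/

section Empirical

/-- The in-degrees and out-degrees of a multigraph. -/
def degrees {n : ℕ} (E : Multigraph n) : BiSeq n := (inDegree E, outDegree E)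

theorem degrees_toMultigraph {n : ℕ} {m d : Fin n → ℕ} (σ : HalfEdge m ≃ HalfEdge d) :
    degrees (toMultigraph σ) = (m, d) :=
  Prod.ext (funext (inDegree_toMultigraph σ)) (funext (outDegree_toMultigraph σ))

/-- The fraction of nodes whose pair of degrees lies in `B`. -/
def emp {n : ℕ} (B : Set (ℕ × ℕ)) (p : BiSeq n) : ℝ :=
  (1 / (n : ℝ)) * ∑ v, B.indicator 1 (p.1 v, p.2 v)

theorem indicator_one_mem_Icc (B : Set (ℕ × ℕ)) (q : ℕ × ℕ) :
    B.indicator (1 : ℕ × ℕ → ℝ) q ∈ Set.Icc (0 : ℝ) 1 := by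
  by_cases h : q ∈ B <;> simp [h]

theorem emp_mem_Icc {n : ℕ} (B : Set (ℕ × ℕ)) (p : BiSeq n) : emp B p ∈ Set.Icc (0 : ℝ) 1 := by
  have h0 : 0 ≤ ∑ v, B.indicator (1 : ℕ × ℕ → ℝ) (p.1 v, p.2 v) :=
    Finset.sum_nonneg fun v _ => (indicator_one_mem_Icc B _).1
  have h1 : ∑ v, B.indicator (1 : ℕ × ℕ → ℝ) (p.1 v, p.2 v) ≤ n := by
    calc _ ≤ ∑ v : Fin n, (1 : ℝ) := Finset.sum_le_sum fun v _ => (indicator_one_mem_Icc B _).2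
      _ = n := by simp
  rw [emp, one_div, inv_mul_eq_div]
  exact ⟨div_nonneg h0 (Nat.cast_nonneg n), div_le_one_of_le₀ h1 (Nat.cast_nonneg n)⟩

theorem abs_emp_adjust_sub_emp_le {n : ℕ} (B : Set (ℕ × ℕ)) (p : BiSeq n) (A : Finset (Fin n)) :
    |emp B (adjust p A) - emp B p| ≤ (1 / (n : ℝ)) * A.card := by
  rw [emp, emp, ← mul_sub, ← Finset.sum_sub_distrib, abs_mul, abs_of_nonneg (by positivity)]
  refine mul_le_mul_of_nonneg_left ?_ (by positivity)
  calc _ ≤ ∑ v, |B.indicator (1 : ℕ × ℕ → ℝ) ((adjust p A).1 v, (adjust p A).2 v) -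
          B.indicator (1 : ℕ × ℕ → ℝ) (p.1 v, p.2 v)| := Finset.abs_sum_le_sum_abs _ _
    _ ≤ ∑ v, if v ∈ A then (1 : ℝ) else 0 := by
        refine Finset.sum_le_sum fun v _ => ?_
        by_cases hv : v ∈ A
        · rw [if_pos hv]
          have h1 := indicator_one_mem_Icc B ((adjust p A).1 v, (adjust p A).2 v)
          have h2 := indicator_one_mem_Icc B (p.1 v, p.2 v)
          exact abs_le.2 ⟨by linarith [h1.1, h2.2], by linarith [h1.2, h2.1]⟩
        · simp [adjust, hv]
    _ = A.card := by simp

theorem integral_indicator_one_prod (F G : PMF ℕ) (B : Set (ℕ × ℕ)) :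
    ∫ q, B.indicator (1 : ℕ × ℕ → ℝ) q ∂(F.toMeasure.prod G.toMeasure) =
      (F.toMeasure.prod G.toMeasure).real B :=
  integral_indicator_one .of_discrete

/-- Accepting the sample and then obtaining a multigraph with atypical empirical degree
distribution is exponentially unlikely. -/
theorem eventually_lintegral_emp_le (F G : PMF ℕ) {α β δ₀ : ℝ}
    (he : 1 - kappa α β + δ₀ < 1) (B : Set (ℕ × ℕ)) {ε : ℝ} (hε : 0 < ε) :
    ∀ᶠ n : ℕ in atTop,
      ∫⁻ p in accept α β δ₀ n, graphProb
        {E | ε < |emp B (degrees E) - (F.toMeasure.prod G.toMeasure).real B|} p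
          ∂(sampleLaw F G n) ≤ ENNReal.ofReal (2 * Real.exp (-(ε ^ 2 / 8) * n)) := by
  set b := (F.toMeasure.prod G.toMeasure).real B
  -- The fraction of adjusted nodes vanishes: ε/2 is reserved for the adjustment, ε/2 for Hoeffding.
  have hsmall : Tendsto (fun n : ℕ => (n : ℝ) ^ (-(1 - (1 - kappa α β + δ₀)))) atTop (𝓝 0) :=
    (tendsto_rpow_neg_atTop (by linarith)).comp tendsto_natCast_atTop_atTop
  filter_upwards [hsmall.eventually_le_const (half_pos hε), eventually_gt_atTop 0] with n hn hn0
  have hn0' : (0 : ℝ) < n := by exact_mod_cast hn0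
  have hoeff := sampleLaw_abs_sum_ge_le F G (B.indicator 1) (c := 1)
    (fun x y _ _ => by
      have := indicator_one_mem_Icc B (x, y)
      exact abs_le.2 ⟨by linarith [this.1], this.2⟩) n (t := n * (ε / 2)) (by positivity)
  rw [integral_indicator_one_prod] at hoeff
  set H : Set (BiSeq n) := {p | n * (ε / 2) ≤
    |(∑ i, B.indicator (1 : ℕ × ℕ → ℝ) (p.1 i, p.2 i)) - n * b|} with hH
  have hbound : ∀ p ∈ accept α β δ₀ n, graphProb
      {E | ε < |emp B (degrees E) - b|} p ≤ H.indicator 1 p := by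
    intro p hp
    by_cases hpH : p ∈ H
    · rw [Set.indicator_of_mem hpH]
      exact graphProb_le_one _ _
    · rw [Set.indicator_of_notMem hpH]
      -- For a typical sample no choice of adjusted nodes and no matching yields an atypical graph,
      -- because the degrees do not depend on the matching.
      refine (graphProb_eq_zero fun A hA => configLaw_eq_zero _ _ fun σ => ?_).le
      rw [Set.mem_ofPred_eq, degrees_toMultigraph, not_lt]
      have h1 := abs_emp_adjust_sub_emp_le B p A
      have h2 : (1 / (n : ℝ)) * A.card ≤ ε / 2 := by
        refine le_trans ?_ hn
        rw [hA, Nat.cast_natAbs, Int.cast_abs, neg_sub, Real.rpow_sub hn0', Real.rpow_one, one_div,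
          inv_mul_eq_div]
        exact div_le_div_of_nonneg_right hp hn0'.le
      have h3 : |emp B p - b| < ε / 2 := by
        rw [hH, Set.mem_ofPred_eq, not_le] at hpH
        have : (∑ i, B.indicator (1 : ℕ × ℕ → ℝ) (p.1 i, p.2 i)) - n * b =
            n * (emp B p - b) := by
          rw [emp]
          field_simp
        rw [this, abs_mul, abs_of_pos hn0'] at hpH
        exact lt_of_mul_lt_mul_left hpH hn0'.le
      calc |emp B (adjust p A) - b| ≤ |emp B (adjust p A) - emp B p| + |emp B p - b| :=
            abs_sub_le _ _ _
        _ ≤ ε := by linarith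
  calc _ ≤ ∫⁻ p in accept α β δ₀ n, H.indicator 1 p ∂(sampleLaw F G n) :=
        setLIntegral_mono' .of_discrete hbound
    _ ≤ ∫⁻ p, H.indicator 1 p ∂(sampleLaw F G n) := setLIntegral_le_lintegral _ _
    _ = sampleLaw F G n H := lintegral_indicator_one .of_discrete
    _ ≤ _ := hoeff
    _ = _ := by
        congr 3
        field_simp
        ring

theorem lintegral_graphProb_le (F G : PMF ℕ) (α β δ₀ : ℝ) (n : ℕ) (T : Set (Multigraph n)) :
    ∫⁻ p in accept α β δ₀ n, graphProb T p ∂(sampleLaw F G n) ≤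
      sampleLaw F G n (accept α β δ₀ n) := by
  rw [← setLIntegral_one]
  exact lintegral_mono fun p => graphProb_le_one _ p

/-- Dropping the intersection with the simple graphs leaves a ratio of unconditional probabilities.
-/
theorem repeatedLaw_apply_le (F G : PMF ℕ) {α β δ₀ : ℝ} {n : ℕ} (T : Set (Multigraph n))
    (h : ∫⁻ p in accept α β δ₀ n, graphProb {E | IsSimple E} p ∂(sampleLaw F G n) ≠ 0) :
    repeatedLaw F G α β δ₀ n T ≤
      (∫⁻ p in accept α β δ₀ n, graphProb {E | IsSimple E} p ∂(sampleLaw F G n))⁻¹ *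
        ∫⁻ p in accept α β δ₀ n, graphProb T p ∂(sampleLaw F G n) := by
  set I := ∫⁻ p in accept α β δ₀ n, graphProb {E | IsSimple E} p ∂(sampleLaw F G n)
  set J := ∫⁻ p in accept α β δ₀ n, graphProb T p ∂(sampleLaw F G n)
  set a := sampleLaw F G n (accept α β δ₀ n)
  have ha_top : a ≠ ∞ := measure_ne_top _ _
  have ha0 : a ≠ 0 := fun h0 => h (setLIntegral_measure_zero _ _ h0)
  rw [repeatedLaw, ProbabilityTheory.cond_apply .of_discrete]
  calc _ ≤ (multigraphLaw F G α β δ₀ n {E | IsSimple E})⁻¹ * multigraphLaw F G α β δ₀ n T := by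
        gcongr
        exact Set.inter_subset_right
    _ = (a⁻¹ * I)⁻¹ * (a⁻¹ * J) := by rw [multigraphLaw_apply, multigraphLaw_apply]
    _ = (a * a⁻¹) * (I⁻¹ * J) := by
        rw [ENNReal.mul_inv (Or.inr ?_) (Or.inr h), inv_inv]
        · ring
        · exact ne_top_of_le_ne_top ha_top (lintegral_graphProb_le F G α β δ₀ n _)
    _ = I⁻¹ * J := by rw [ENNReal.mul_inv_cancel ha0 ha_top, one_mul]

theorem tendsto_repeatedLaw_emp (F G : PMF ℕ) {μ α β δ₀ : ℝ} (hμ : 0 < μ)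
    (hF : HasSum (fun k : ℕ => (k : ℝ) * (F k).toReal) μ)
    (hG : HasSum (fun k : ℕ => (k : ℝ) * (G k).toReal) μ)
    (he₁ : 1 / 2 < 1 - kappa α β + δ₀) (he₂ : 1 - kappa α β + δ₀ < 1)
    (B : Set (ℕ × ℕ)) {ε : ℝ} (hε : 0 < ε) :
    Tendsto (fun n : ℕ => repeatedLaw F G α β δ₀ n
      {E | ε < |emp B (degrees E) - (F.toMeasure.prod G.toMeasure).real B|}) atTop (𝓝 0) := by
  -- Half of the Hoeffding rate ε²/8, so that the quotient still decays exponentially.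
  have hη : 0 < ε ^ 2 / 16 := by positivity
  have hlim : Tendsto (fun n : ℕ => ENNReal.ofReal (2 * Real.exp (-(ε ^ 2 / 16 * n)))) atTop
      (𝓝 0) := by
    have h1 : Tendsto (fun n : ℕ => ε ^ 2 / 16 * (n : ℝ)) atTop atTop :=
      tendsto_natCast_atTop_atTop.const_mul_atTop hη
    have h2 := ENNReal.tendsto_ofReal
      ((Real.tendsto_exp_neg_atTop_nhds_zero.comp h1).const_mul 2)
    rwa [mul_zero, ENNReal.ofReal_zero] at h2
  refine tendsto_of_tendsto_of_tendsto_of_le_of_le' tendsto_const_nhds hlim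
    (Eventually.of_forall fun _ => zero_le) ?_
  filter_upwards [eventually_exp_le_lintegral_isSimple F G hμ hF hG he₁ he₂ hη,
    eventually_lintegral_emp_le F G he₂ B hε] with n h₁ h₂
  have hpos := (ENNReal.ofReal_pos.2 (Real.exp_pos _)).trans_le h₁
  calc _ ≤ _ := repeatedLaw_apply_le F G _ hpos.ne'
    _ ≤ (ENNReal.ofReal (Real.exp (-(ε ^ 2 / 16) * n)))⁻¹ *
        ENNReal.ofReal (2 * Real.exp (-(ε ^ 2 / 8) * n)) := by gcongr
    _ = _ := by
        rw [← ENNReal.ofReal_inv_of_pos (Real.exp_pos _),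
          ← ENNReal.ofReal_mul (inv_nonneg.2 (Real.exp_nonneg _)), ← Real.exp_neg, mul_left_comm,
          ← Real.exp_add]
        congr 3
        ring

theorem eventually_multigraphLaw_isSimple_pos (F G : PMF ℕ) {μ α β δ₀ : ℝ} (hμ : 0 < μ)
    (hF : HasSum (fun k : ℕ => (k : ℝ) * (F k).toReal) μ)
    (hG : HasSum (fun k : ℕ => (k : ℝ) * (G k).toReal) μ)
    (he₁ : 1 / 2 < 1 - kappa α β + δ₀) (he₂ : 1 - kappa α β + δ₀ < 1) :
    ∀ᶠ n : ℕ in atTop, 0 < multigraphLaw F G α β δ₀ n {E | IsSimple E} := by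
  filter_upwards [eventually_exp_le_lintegral_isSimple F G hμ hF hG he₁ he₂ one_pos] with n hn
  rw [multigraphLaw_apply]
  exact ENNReal.mul_pos (ENNReal.inv_ne_zero.2 (measure_ne_top _ _))
    ((ENNReal.ofReal_pos.2 (Real.exp_pos _)).trans_le hn).ne'

theorem jointDegree_eq_integral (F G : PMF ℕ) (α β δ₀ : ℝ) (n i j : ℕ)
    [IsFiniteMeasure (repeatedLaw F G α β δ₀ n)] :
    jointDegree F G α β δ₀ n i j =
      ∫ E, emp {(i, j)} (degrees E) ∂(repeatedLaw F G α β δ₀ n) := by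
  have h : ∀ v : Fin n, (fun E : Multigraph n =>
      ({(i, j)} : Set (ℕ × ℕ)).indicator (1 : ℕ × ℕ → ℝ) ((degrees E).1 v, (degrees E).2 v)) =
      {E : Multigraph n | inDegree E v = i ∧ outDegree E v = j}.indicator 1 := by
    intro v
    ext E
    simp [degrees, Set.indicator_apply]
  simp only [emp]
  rw [integral_const_mul, integral_finsetSum]
  · simp only [h, integral_indicator_one MeasurableSet.of_discrete]
    rfl
  · intro v _
    rw [h]
    exact (integrable_const (1 : ℝ)).indicator .of_discrete

/-- Passes from convergence in probability to convergence of means: the deviation is at most ε off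
the exceptional event and at most 1 on it. -/
theorem abs_integral_sub_le {Ω : Type*} [MeasurableSpace Ω] [DiscreteMeasurableSpace Ω]
    (ρ : Measure Ω) [IsProbabilityMeasure ρ] (f : Ω → ℝ) (hf : ∀ ω, f ω ∈ Set.Icc (0 : ℝ) 1)
    {b ε : ℝ} (hb : b ∈ Set.Icc (0 : ℝ) 1) (hε : 0 ≤ ε) :
    |(∫ ω, f ω ∂ρ) - b| ≤ ε + ρ.real {ω | ε < |f ω - b|} := by
  have hint : Integrable f ρ :=
    Integrable.of_mem_Icc 0 1 Measurable.of_discrete.aemeasurable (Eventually.of_forall hf)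
  set S := {ω | ε < |f ω - b|}
  calc |(∫ ω, f ω ∂ρ) - b| = |∫ ω, (f ω - b) ∂ρ| := by
        rw [integral_sub hint (integrable_const b)]
        simp
    _ ≤ ∫ ω, |f ω - b| ∂ρ := abs_integral_le_integral_abs
    _ ≤ ∫ ω, (ε + S.indicator 1 ω) ∂ρ := by
        refine integral_mono (hint.sub (integrable_const b)).abs
          ((integrable_const ε).add ((integrable_const (1 : ℝ)).indicator .of_discrete))
          fun ω => ?_
        by_cases hω : ω ∈ S
        · rw [Set.indicator_of_mem hω]
          have : |f ω - b| ≤ 1 :=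
            abs_le.2 ⟨by linarith [(hf ω).1, hb.2], by linarith [(hf ω).2, hb.1]⟩
          exact this.trans (le_add_of_nonneg_left hε)
        · rw [Set.indicator_of_notMem hω, add_zero]
          exact not_lt.1 hω
    _ = ε + ρ.real S := by
        rw [integral_add (g := S.indicator 1) (integrable_const ε)
          ((integrable_const (1 : ℝ)).indicator .of_discrete),
          integral_indicator_one .of_discrete]
        simp

theorem multigraphLaw_ne_top {F G : PMF ℕ} {α β δ₀ : ℝ} {n : ℕ} (T : Set (Multigraph n)) :
    multigraphLaw F G α β δ₀ n T ≠ ∞ := by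
  refine ne_top_of_le_ne_top ENNReal.one_ne_top ?_
  rw [multigraphLaw_apply]
  refine le_trans ?_ (ENNReal.inv_mul_le_one (sampleLaw F G n (accept α β δ₀ n)))
  gcongr
  exact lintegral_graphProb_le F G α β δ₀ n T

theorem prod_toMeasure_real_singleton (F G : PMF ℕ) (i j : ℕ) :
    (F.toMeasure.prod G.toMeasure).real {(i, j)} = (F i).toReal * (G j).toReal := by
  rw [← Set.singleton_prod_singleton, measureReal_prod_prod, measureReal_def, measureReal_def,
    PMF.toMeasure_apply_singleton _ _ (measurableSet_singleton _),
    PMF.toMeasure_apply_singleton _ _ (measurableSet_singleton _)]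

theorem prod_toMeasure_real_singleton_prod_univ (F G : PMF ℕ) (k : ℕ) :
    (F.toMeasure.prod G.toMeasure).real ({k} ×ˢ Set.univ) = (F k).toReal := by
  rw [measureReal_prod_prod, measureReal_def,
    PMF.toMeasure_apply_singleton _ _ (measurableSet_singleton _)]
  simp

theorem prod_toMeasure_real_univ_prod_singleton (F G : PMF ℕ) (k : ℕ) :
    (F.toMeasure.prod G.toMeasure).real (Set.univ ×ˢ {k}) = (G k).toReal := by
  rw [measureReal_prod_prod, measureReal_def (μ := G.toMeasure),
    PMF.toMeasure_apply_singleton _ _ (measurableSet_singleton _)]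
  simp

theorem empIn_eq_emp {n : ℕ} (E : Multigraph n) (k : ℕ) :
    empIn E k = emp ({k} ×ˢ Set.univ) (degrees E) := by
  simp [empIn, emp, degrees, Set.indicator_apply]

theorem empOut_eq_emp {n : ℕ} (E : Multigraph n) (k : ℕ) :
    empOut E k = emp (Set.univ ×ˢ {k}) (degrees E) := by
  simp [empOut, emp, degrees, Set.indicator_apply]

theorem tendsto_jointDegree (F G : PMF ℕ) {μ α β δ₀ : ℝ} (hμ : 0 < μ)
    (hF : HasSum (fun k : ℕ => (k : ℝ) * (F k).toReal) μ)
    (hG : HasSum (fun k : ℕ => (k : ℝ) * (G k).toReal) μ)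
    (he₁ : 1 / 2 < 1 - kappa α β + δ₀) (he₂ : 1 - kappa α β + δ₀ < 1) (i j : ℕ) :
    Tendsto (fun n : ℕ => jointDegree F G α β δ₀ n i j) atTop
      (𝓝 ((F i).toReal * (G j).toReal)) := by
  rw [← prod_toMeasure_real_singleton]
  rw [Metric.tendsto_atTop']
  intro ε hε
  have hlim := tendsto_repeatedLaw_emp F G hμ hF hG he₁ he₂ {(i, j)} (half_pos hε)
  refine (eventually_atTop.1 ?_).imp fun N hN n hn => hN n hn.le
  filter_upwards [eventually_multigraphLaw_isSimple_pos F G hμ hF hG he₁ he₂,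
    hlim.eventually_lt_const (ENNReal.ofReal_pos.2 (half_pos hε))] with n hpos hsmall
  have : IsProbabilityMeasure (repeatedLaw F G α β δ₀ n) :=
    cond_isProbabilityMeasure_of_finite hpos.ne' (multigraphLaw_ne_top _)
  rw [Real.dist_eq, jointDegree_eq_integral]
  refine (abs_integral_sub_le _ _ (fun E => emp_mem_Icc _ _)
    ⟨measureReal_nonneg, measureReal_le_one⟩ (half_pos hε).le).trans_lt ?_
  have : (repeatedLaw F G α β δ₀ n).real {E | ε / 2 < |emp {(i, j)} (degrees E) -
      (F.toMeasure.prod G.toMeasure).real {(i, j)}|} < ε / 2 :=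
    (ENNReal.lt_ofReal_iff_toReal_lt (measure_ne_top _ _)).1 hsmall
  linarith

end Empirical

end DirectedConfig

end

/-- Of the tail bounds only the resulting range `1/2 < 1 - κ + δ₀ < 1` of the acceptance exponent is
needed: simple graphs are not exponentially unlikely, atypical degree distributions are. -/
theorem proposition4 (F G : PMF ℕ) (μ α β δ₀ : ℝ) (LF LG : ℝ → ℝ)
    (hμ : 0 < μ)
    (hFmean : HasSum (fun k : ℕ => (k : ℝ) * (F k).toReal) μ)
    (hGmean : HasSum (fun k : ℕ => (k : ℝ) * (G k).toReal) μ)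
    (hα : 1 < α) (hβ : 1 < β)
    (hLF : DirectedConfig.SlowlyVarying LF) (hLG : DirectedConfig.SlowlyVarying LG)
    (hFtail : ∀ x : ℝ, 0 < x → DirectedConfig.tail F x ≤ x ^ (-α) * LF x)
    (hGtail : ∀ x : ℝ, 0 < x → DirectedConfig.tail G x ≤ x ^ (-β) * LG x)
    (hδ₀ : 0 < δ₀) (hδ₀κ : δ₀ < DirectedConfig.kappa α β) :
    (∀ᶠ n : ℕ in atTop,
      0 < DirectedConfig.multigraphLaw F G α β δ₀ n {E | DirectedConfig.IsSimple E}) ∧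
    (∀ i j : ℕ, Tendsto (fun n : ℕ => DirectedConfig.jointDegree F G α β δ₀ n i j) atTop
      (𝓝 ((F i).toReal * (G j).toReal))) ∧
    (∀ k : ℕ,
      (∀ ε : ℝ, 0 < ε → Tendsto
        (fun n : ℕ => DirectedConfig.repeatedLaw F G α β δ₀ n
          {E | ε < |DirectedConfig.empIn E k - (F k).toReal|}) atTop (𝓝 0)) ∧
      (∀ ε : ℝ, 0 < ε → Tendsto
        (fun n : ℕ => DirectedConfig.repeatedLaw F G α β δ₀ n
          {E | ε < |DirectedConfig.empOut E k - (G k).toReal|}) atTop (𝓝 0))) := by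
  have hκ : DirectedConfig.kappa α β ≤ 1 / 2 := min_le_right _ _
  have he₁ : 1 / 2 < 1 - DirectedConfig.kappa α β + δ₀ := by linarith
  have he₂ : 1 - DirectedConfig.kappa α β + δ₀ < 1 := by linarith
  refine ⟨DirectedConfig.eventually_multigraphLaw_isSimple_pos F G hμ hFmean hGmean he₁ he₂,
    DirectedConfig.tendsto_jointDegree F G hμ hFmean hGmean he₁ he₂, fun k =>
      ⟨fun ε hε => ?_, fun ε hε => ?_⟩⟩
  · simpa only [DirectedConfig.empIn_eq_emp,
      DirectedConfig.prod_toMeasure_real_singleton_prod_univ] using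
      DirectedConfig.tendsto_repeatedLaw_emp F G hμ hFmean hGmean he₁ he₂ ({k} ×ˢ Set.univ) hε
  · simpa only [DirectedConfig.empOut_eq_emp,
      DirectedConfig.prod_toMeasure_real_univ_prod_singleton] using
      DirectedConfig.tendsto_repeatedLaw_emp F G hμ hFmean hGmean he₁ he₂ (Set.univ ×ˢ {k}) hε
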